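/- Let $n\ge 1$ and let $\mathbb{D}^n=\{z\in\mathbb{C}^n : |z_i|<1,\ i=1,\dots,n\}$. Let $H^2(\mathbb{D}^n)$ be the Hardy space of the polydisc, i.e. the Hilbert space of all holomorphic functions $f$ on $\mathbb{D}^n$ with $$\|f\|^2=\sup_{0\le r<1}\int_{\mathbb{T}^n}|f(rz)|^2\,d\theta<\infty ,$$ where $d\theta$ is the normalized Lebesgue measure on the torus $\mathbb{T}^n$, and let $M_{z_i}$ denote multiplication by the coordinate function $z_i$ on $H^2(\mathbb{D}^n)$. A closed subspace $\mathcal{Q}\subseteq H^2(\mathbb{D}^n)$ is called a quotient module of $H^2(\mathbb{D}^n)$ if $M_{z_i}\mathcal{Q}^\perp\subseteq\mathcal{Q}^\perp$ for all $i=1,\dots,n$ (equivalently, if $\mathcal{Q}$ is invariant under all $M_{z_i}^*$). For a quotient module $\mathcal{Q}$ put $C_{z_i}=P_{\mathcal{Q}}M_{z_i}|_{\mathcal{Q}}$, where $P_{\mathcal{Q}}$ is the orthogonal projection onto $\mathcal{Q}$; $\mathcal{Q}$ is called doubly commuting if $C_{z_i}C_{z_j}^*=C_{z_j}^*C_{z_i}$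 for all $i\ne j$. For closed subspaces $\mathcal{Q}_1,\dots,\mathcal{Q}_n$ of $H^2(\mathbb{D})$, let $\mathcal{Q}_1\otimes\cdots\otimes\mathcal{Q}_n$ be their Hilbert space tensor product, regarded as a closed subspace of $H^2(\mathbb{D}^n)$ through the unitary $H^2(\mathbb{D})\otimes\cdots\otimes H^2(\mathbb{D})\cong H^2(\mathbb{D}^n)$ that sends $z^{l_1}\otimes\cdots\otimes z^{l_n}$ to $z_1^{l_1}\cdots z_n^{l_n}$; that is, the closed linear span of the functions $(z_1,\dots,z_n)\mapsto f_1(z_1)\cdots f_n(z_n)$ with $f_i\in\mathcal{Q}_i$ for $i=1,\dots,n$. **Theorem.** Let $\mathcal{Q}$ be a quotient module of $H^2(\mathbb{D}^n)$. Then $\mathcal{Q}$ is doubly commuting if and only if there exist quotient modules $\mathcal{Q}_1,\dots,\mathcal{Q}_n$ of $H^2(\mathbb{D})$ such that $$\mathcal{Q}=\mathcal{Q}_1\otimes\cdots\otimes\mathcal{Q}_n .$$ -/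

import Mathlib

open MeasureTheory

noncomputable section

namespace Hardy

/-- The open unit polydisc `𝔻ⁿ` in `ℂⁿ`. -/
def polydisc (n : ℕ) : Set (Fin n → ℂ) := {z | ∀ i, ‖z i‖ < 1}

/-- The normalized Lebesgue (Haar) measure on the torus `𝕋ⁿ = (ℝ/ℤ)ⁿ`. -/
def torusMeasure (n : ℕ) : Measure (UnitAddTorus (Fin n)) :=
  Measure.pi fun _ => AddCircle.haarAddCircle

instance (n : ℕ) : IsProbabilityMeasure (torusMeasure n) := by
  unfold torusMeasure; infer_instance

instance (n : ℕ) : (torusMeasure n).IsAddLeftInvariant := by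
  unfold torusMeasure; infer_instance

/-- The point `(w₁ ζ₁, …, wₙ ζₙ)`, where `ζᵢ` is the point of the unit circle with parameter `tᵢ`. -/
def torusPoint {n : ℕ} (w : Fin n → ℂ) (t : UnitAddTorus (Fin n)) : Fin n → ℂ :=
  fun i => w i * (AddCircle.toCircle (t i) : ℂ)

lemma isOpen_polydisc (n : ℕ) : IsOpen (polydisc n) := by
  simp only [polydisc, Set.ofPred_forall]
  exact isOpen_iInter_of_finite fun i => isOpen_lt (by fun_prop) continuous_const

lemma torusPoint_mem {n : ℕ} {w : Fin n → ℂ} (hw : w ∈ polydisc n) (t : UnitAddTorus (Fin n)) :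
    torusPoint w t ∈ polydisc n := fun i => by simpa [torusPoint, Circle.norm_coe] using hw i

lemma continuous_torusPoint {n : ℕ} (w : Fin n → ℂ) : Continuous (torusPoint w) := by
  unfold torusPoint; fun_prop

lemma continuous_comp_torusPoint {n : ℕ} {f : (Fin n → ℂ) → ℂ}
    (hf : DifferentiableOn ℂ f (polydisc n)) {w : Fin n → ℂ} (hw : w ∈ polydisc n) :
    Continuous fun t => f (torusPoint w t) :=
  hf.continuousOn.comp_continuous (continuous_torusPoint w) (torusPoint_mem hw)

lemma integrable_of_continuous {n : ℕ} {E : Type*} [NormedAddCommGroup E]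
    {F : UnitAddTorus (Fin n) → E} (hF : Continuous F) :
    Integrable F (torusMeasure n) :=
  hF.integrable_of_hasCompactSupport (HasCompactSupport.of_compactSpace F)

lemma parseval {n : ℕ} (F : C(UnitAddTorus (Fin n), ℂ)) :
    HasSum (fun k : Fin n → ℤ => ‖∫ t, UnitAddTorus.mFourier (-k) t * F t ∂torusMeasure n‖ ^ 2)
      (∫ t, ‖F t‖ ^ 2 ∂torusMeasure n) := by
  let _ : MeasureSpace UnitAddCircle := ⟨AddCircle.haarAddCircle⟩
  have _ : IsProbabilityMeasure (volume : Measure UnitAddCircle) :=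
    inferInstanceAs (IsProbabilityMeasure AddCircle.haarAddCircle)
  have h := UnitAddTorus.hasSum_sq_mFourierCoeff (ContinuousMap.toLp 2 volume ℂ F)
  simp only [UnitAddTorus.mFourierCoeff_toLp] at h
  convert h using 1
  · rfl
  apply integral_congr_ae
  filter_upwards [ContinuousMap.coeFn_toLp (p := 2) (𝕜 := ℂ) (torusMeasure n) F] with t ht
  exact congrArg (fun x => ‖x‖ ^ 2) ht.symm

lemma fourier_int (m : ℤ) :
    ∫ s : UnitAddCircle, fourier m s ∂AddCircle.haarAddCircle = if m = 0 then 1 else 0 := by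
  have h := (orthonormal_iff_ite.mp (orthonormal_fourier (T := (1 : ℝ)))) 0 m
  rw [ContinuousMap.inner_toLp] at h
  simpa [eq_comm] using h

/-- Fourier coefficients on circles of a holomorphic function on the disc. -/
lemma one_var {g : ℂ → ℂ} (hg : DifferentiableOn ℂ g (Metric.ball 0 1)) (m : ℤ) :
    ∃ c : ℂ, ∀ w : ℂ, ‖w‖ < 1 →
      ∫ s : UnitAddCircle, fourier (-m) s * g (w * (AddCircle.toCircle s : ℂ))
        ∂AddCircle.haarAddCircle = if 0 ≤ m then c * w ^ m.toNat else 0 := by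
  have hp : ∀ z : ℂ, ‖z‖ < 1 → HasSum (fun j : ℕ => (iteratedDeriv j g 0 / (j.factorial : ℂ)) * z ^ j) (g z) := by
    intro z hz
    have := Complex.hasSum_taylorSeries_on_ball hg (by simpa using hz)
    simpa [div_eq_inv_mul, mul_assoc, mul_comm, mul_left_comm] using this
  set a : ℕ → ℂ := fun j => iteratedDeriv j g 0 / (j.factorial : ℂ) with ha
  refine ⟨a m.toNat, fun w hw => ?_⟩
  have hs : Summable fun j : ℕ => ‖a j * w ^ j‖ := (hp w hw).summable.norm
  have key := hasSum_integral_of_summable_integral_norm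
    (μ := (AddCircle.haarAddCircle : Measure UnitAddCircle))
    (F := fun (j : ℕ) s => fourier (-m) s * (a j * (w * (AddCircle.toCircle s : ℂ)) ^ j)) ?_ ?_
  · have hg' : ∀ s : UnitAddCircle, ∑' j : ℕ, fourier (-m) s *
        (a j * (w * (AddCircle.toCircle s : ℂ)) ^ j) =
        fourier (-m) s * g (w * (AddCircle.toCircle s : ℂ)) := by
      intro s
      rw [tsum_mul_left, (hp _ (by simpa [Circle.norm_coe] using hw)).tsum_eq]
    simp_rw [hg'] at key
    · refine key.unique ?_
      have : (fun j : ℕ => ∫ s : UnitAddCircle, fourier (-m) s *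
          (a j * (w * (AddCircle.toCircle s : ℂ)) ^ j) ∂AddCircle.haarAddCircle) =
          fun j : ℕ => if (j : ℤ) = m then a j * w ^ j else 0 := by
        funext j
        have : (fun s : UnitAddCircle => fourier (-m) s *
          (a j * (w * (AddCircle.toCircle s : ℂ)) ^ j)) =
            fun s => (a j * w ^ j) * fourier ((j : ℤ) - m) s := by
          funext s
          rw [sub_eq_add_neg, fourier_add, fourier_apply (n := (j : ℤ))]
          simp [AddCircle.toCircle_nsmul]
          ring
        rw [this, integral_const_mul, fourier_int]
        simp [sub_eq_zero]
      rw [this]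
      split_ifs with h
      · have e : (fun j : ℕ => if (j : ℤ) = m then a j * w ^ j else 0) =
            fun j : ℕ => if j = m.toNat then a m.toNat * w ^ m.toNat else 0 := by
          funext j
          by_cases hj : j = m.toNat
          · subst hj; simp [h]
          · rw [if_neg hj, if_neg]; omega
        rw [e]
        exact hasSum_ite_eq m.toNat (a m.toNat * w ^ m.toNat)
      · have e : (fun j : ℕ => if (j : ℤ) = m then a j * w ^ j else 0) = fun j : ℕ => 0 := by
          funext j
          rw [if_neg]; omega
        rw [e]
        exact hasSum_zero
  · intro j
    exact Continuous.integrable_of_hasCompactSupport (by fun_prop) (HasCompactSupport.of_compactSpace _)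
  · convert hs using 2 with j
    simp [fourier_apply, Circle.norm_coe]

/-- The `k`-th Fourier coefficient of `f` on the torus of polyradius `w`. -/
def torusCoeff {n : ℕ} (f : (Fin n → ℂ) → ℂ) (w : Fin n → ℂ) (k : Fin n → ℤ) : ℂ :=
  ∫ t, UnitAddTorus.mFourier (-k) t * f (torusPoint w t) ∂torusMeasure n

lemma integral_eq_slice {n : ℕ} (i : Fin n) {F : UnitAddTorus (Fin n) → ℂ} (hF : Continuous F) :
    ∫ t, F t ∂torusMeasure n =
      ∫ t, ∫ s : UnitAddCircle, F (Pi.single i s + t) ∂AddCircle.haarAddCircle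
        ∂torusMeasure n := by
  rw [integral_integral_swap]
  · simp only [integral_add_left_eq_self (μ := torusMeasure n) F]
    simp
  · have hc : Continuous fun p : UnitAddTorus (Fin n) × UnitAddCircle =>
        F (Pi.single i p.2 + p.1) :=
      hF.comp (((continuous_single i).comp continuous_snd).add continuous_fst)
    exact hc.integrable_of_hasCompactSupport (HasCompactSupport.of_compactSpace _)

lemma mFourier_single_add {n : ℕ} (k : Fin n → ℤ) (i : Fin n) (s : UnitAddCircle)
    (t : UnitAddTorus (Fin n)) :
    UnitAddTorus.mFourier k (Pi.single i s + t) =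
      fourier (k i) s * UnitAddTorus.mFourier k t := by
  simp only [UnitAddTorus.mFourier, ContinuousMap.coe_mk, Pi.add_apply,
    fourier_apply, smul_add, AddCircle.toCircle_add, Circle.coe_mul, Finset.prod_mul_distrib]
  congr 1
  rw [Finset.prod_eq_single i]
  · simp
  · intro j _ hj; simp [hj]
  · simp

lemma slice_aux {n : ℕ} {f : (Fin n → ℂ) → ℂ} (hf : DifferentiableOn ℂ f (polydisc n))
    {w : Fin n → ℂ} (hw : w ∈ polydisc n) (k : Fin n → ℤ) (i : Fin n)
    (t : UnitAddTorus (Fin n)) :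
    ∃ c : ℂ, ∀ x : ℂ, ‖x‖ < 1 → ∫ s : UnitAddCircle,
      UnitAddTorus.mFourier (-k) (Pi.single i s + t) *
        f (torusPoint (Function.update w i x) (Pi.single i s + t)) ∂AddCircle.haarAddCircle =
      if 0 ≤ k i then c * x ^ (k i).toNat else 0 := by
  set g : ℂ → ℂ := fun ζ => f (Function.update (torusPoint w t) i
    (ζ * (AddCircle.toCircle (t i) : ℂ))) with hg
  have hgd : DifferentiableOn ℂ g (Metric.ball 0 1) := by
    refine hf.comp (t := polydisc n) ?_ ?_
    · apply Differentiable.differentiableOn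
      rw [differentiable_pi]
      intro j
      rcases eq_or_ne j i with rfl | hj
      · simp
      · simp [hj]
    · intro ζ hζ j
      rcases eq_or_ne j i with rfl | hj
      · simpa [Circle.norm_coe] using hζ
      · simpa [hj] using torusPoint_mem hw t j
  obtain ⟨c, hc⟩ := one_var hgd (k i)
  refine ⟨UnitAddTorus.mFourier (-k) t * c, fun x hx => ?_⟩
  have e : ∀ s : UnitAddCircle, UnitAddTorus.mFourier (-k) (Pi.single i s + t) *
        f (torusPoint (Function.update w i x) (Pi.single i s + t)) =
      UnitAddTorus.mFourier (-k) t *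
        (fourier (-(k i)) s * g (x * (AddCircle.toCircle s : ℂ))) := by
    intro s
    have : torusPoint (Function.update w i x) (Pi.single i s + t) =
        Function.update (torusPoint w t) i
          (x * (AddCircle.toCircle s : ℂ) * (AddCircle.toCircle (t i) : ℂ)) := by
      funext j
      rcases eq_or_ne j i with rfl | hj
      · simp [torusPoint, AddCircle.toCircle_add, mul_assoc]
      · simp [torusPoint, hj]
    rw [mFourier_single_add, this, hg, Pi.neg_apply]
    ring
  simp_rw [e]
  rw [integral_const_mul, hc x hx]
  split_ifs <;> ring

lemma update_mem {n : ℕ} {w : Fin n → ℂ} (hw : w ∈ polydisc n) (i : Fin n) {x : ℂ}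
    (hx : ‖x‖ < 1) : Function.update w i x ∈ polydisc n := by
  intro j
  rcases eq_or_ne j i with rfl | hj
  · simpa using hx
  · simpa [hj] using hw j

lemma torusCoeff_slice {n : ℕ} {f : (Fin n → ℂ) → ℂ} (hf : DifferentiableOn ℂ f (polydisc n))
    {w : Fin n → ℂ} (hw : w ∈ polydisc n) (k : Fin n → ℤ) (i : Fin n) {x : ℂ} (hx : ‖x‖ < 1) :
    torusCoeff f (Function.update w i x) k = ∫ t, ∫ s : UnitAddCircle,
      UnitAddTorus.mFourier (-k) (Pi.single i s + t) *
        f (torusPoint (Function.update w i x) (Pi.single i s + t)) ∂AddCircle.haarAddCircle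
        ∂torusMeasure n :=
  integral_eq_slice i ((map_continuous _).mul (continuous_comp_torusPoint hf (update_mem hw i hx)))

lemma torusCoeff_eq_zero {n : ℕ} {f : (Fin n → ℂ) → ℂ} (hf : DifferentiableOn ℂ f (polydisc n))
    {w : Fin n → ℂ} (hw : w ∈ polydisc n) (k : Fin n → ℤ) (i : Fin n) (hk : k i < 0) :
    torusCoeff f w k = 0 := by
  have := torusCoeff_slice hf hw k i (hw i)
  rw [Function.update_eq_self] at this
  rw [this]
  refine integral_eq_zero_of_ae (Filter.Eventually.of_forall fun t => ?_)
  obtain ⟨c, hc⟩ := slice_aux hf hw k i t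
  have := hc _ (hw i)
  rw [Function.update_eq_self, if_neg (not_le.2 hk)] at this
  exact this

lemma torusCoeff_update {n : ℕ} {f : (Fin n → ℂ) → ℂ} (hf : DifferentiableOn ℂ f (polydisc n))
    {w : Fin n → ℂ} (hw : w ∈ polydisc n) (k : Fin n → ℕ) (i : Fin n) {x y : ℂ} (hx : ‖x‖ < 1)
    (hy : ‖y‖ < 1) :
    torusCoeff f (Function.update w i x) (fun j => (k j : ℤ)) * y ^ k i =
      torusCoeff f (Function.update w i y) (fun j => (k j : ℤ)) * x ^ k i := by
  rw [torusCoeff_slice hf hw _ i hx, torusCoeff_slice hf hw _ i hy, ← integral_mul_const,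
    ← integral_mul_const]
  congr 1
  funext t
  obtain ⟨c, hc⟩ := slice_aux hf hw (fun j => (k j : ℤ)) i t
  rw [hc x hx, hc y hy]
  simp
  ring

/-- The Taylor coefficients of `f` at the origin, through Cauchy's formula on the torus of
radius `1/2`. -/
def coeff {n : ℕ} (f : (Fin n → ℂ) → ℂ) (k : Fin n → ℕ) : ℂ :=
  torusCoeff f (fun _ => 1 / 2) (fun j => (k j : ℤ)) * 2 ^ ∑ i, k i

lemma half_mem (n : ℕ) : (fun _ => 1 / 2 : Fin n → ℂ) ∈ polydisc n := fun i => by norm_num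

lemma torusCoeff_eq {n : ℕ} {f : (Fin n → ℂ) → ℂ} (hf : DifferentiableOn ℂ f (polydisc n))
    {w : Fin n → ℂ} (hw : w ∈ polydisc n) (k : Fin n → ℕ) :
    torusCoeff f w (fun j => (k j : ℤ)) = coeff f k * ∏ i, w i ^ k i := by
  classical
  have key : ∀ S : Finset (Fin n),
      torusCoeff f (S.piecewise w fun _ => 1 / 2) (fun j => (k j : ℤ)) =
      torusCoeff f (fun _ => 1 / 2) (fun j => (k j : ℤ)) * ∏ i ∈ S, (2 * w i) ^ k i := by
    intro S
    induction S using Finset.induction_on with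
    | empty => simp
    | insert i S hi ih =>
      have hm : (S.piecewise w fun _ => 1 / 2) ∈ polydisc n := by
        intro j
        by_cases hj : j ∈ S
        · simpa [hj] using hw j
        · simp [hj]; norm_num
      have := torusCoeff_update hf hm k i (hw i) (y := 1 / 2) (by norm_num)
      rw [← Finset.piecewise_insert] at this
      have h2 : Function.update (S.piecewise w fun _ => (1 / 2 : ℂ)) i (1 / 2) =
          S.piecewise w fun _ => 1 / 2 := by
        rw [Function.update_eq_self_iff]; simp [hi]
      rw [h2, ih] at this
      rw [Finset.prod_insert hi]
      have h3 : torusCoeff f ((insert i S).piecewise w fun _ => 1 / 2) (fun j => (k j : ℤ)) =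
          torusCoeff f ((insert i S).piecewise w fun _ => 1 / 2) (fun j => (k j : ℤ)) *
            (1 / 2) ^ k i * 2 ^ k i := by
        rw [mul_assoc, ← mul_pow]; norm_num
      rw [h3, this, mul_pow]
      ring
  have := key Finset.univ
  rw [Finset.piecewise_univ] at this
  rw [this, coeff]
  simp_rw [mul_pow]
  rw [Finset.prod_mul_distrib, Finset.prod_pow_eq_pow_sum]
  ring

/-- The integral mean `∫_{𝕋ⁿ} |f(r z)|² dθ`. -/
def sqMean {n : ℕ} (f : (Fin n → ℂ) → ℂ) (r : ℝ) : ℝ :=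
  ∫ t, ‖f (torusPoint (fun _ => (r : ℂ)) t)‖ ^ 2 ∂torusMeasure n

lemma const_mem {n : ℕ} {r : ℝ} (hr : r ∈ Set.Ico (0 : ℝ) 1) :
    (fun _ => (r : ℂ) : Fin n → ℂ) ∈ polydisc n := fun i => by
  simpa [abs_of_nonneg hr.1] using hr.2

lemma cast_injective (n : ℕ) :
    Function.Injective fun (k : Fin n → ℕ) (j : Fin n) => (k j : ℤ) := fun a b h => by
  funext j
  simpa using congrFun h j

lemma hasSum_sqMean {n : ℕ} {f : (Fin n → ℂ) → ℂ} (hf : DifferentiableOn ℂ f (polydisc n))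
    {r : ℝ} (hr : r ∈ Set.Ico (0 : ℝ) 1) :
    HasSum (fun k : Fin n → ℕ => ‖coeff f k‖ ^ 2 * r ^ (2 * ∑ i, k i)) (sqMean f r) := by
  have hm := const_mem (n := n) hr
  have h := parseval ⟨_, continuous_comp_torusPoint hf hm⟩
  simp only [ContinuousMap.coe_mk] at h
  rw [← (cast_injective n).hasSum_iff] at h
  · refine h.congr_fun fun k => ?_
    have := torusCoeff_eq hf hm k
    rw [torusCoeff] at this
    simp only [Function.comp]
    rw [this, Finset.prod_pow_eq_pow_sum, norm_mul, norm_pow, Complex.norm_real,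
      Real.norm_of_nonneg hr.1]
    ring
  · intro k hk
    have : ∃ i, k i < 0 := by
      by_contra! hc
      exact hk ⟨fun i => (k i).toNat, by funext i; simp [hc i]⟩
    obtain ⟨i, hi⟩ := this
    have := torusCoeff_eq_zero hf hm k i hi
    rw [torusCoeff] at this
    rw [this]; simp

lemma eq_zero_of_coeff {n : ℕ} {f : (Fin n → ℂ) → ℂ} (hf : DifferentiableOn ℂ f (polydisc n))
    (h0 : coeff f = 0) {z : Fin n → ℂ} (hz : z ∈ polydisc n) : f z = 0 := by
  have hA : ∀ k, torusCoeff f z k = 0 := by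
    intro k
    by_cases hk : ∃ i, k i < 0
    · obtain ⟨i, hi⟩ := hk
      exact torusCoeff_eq_zero hf hz k i hi
    · push Not at hk
      have : k = fun i => ((k i).toNat : ℤ) := by funext i; simp [hk i]
      rw [this, torusCoeff_eq hf hz, h0]
      simp
  have hA' : UnitAddTorus.mFourierCoeff (fun t => f (torusPoint z t)) = 0 := by
    funext k
    exact hA k
  have := UnitAddTorus.hasSum_mFourier_series_apply_of_summable
    (f := ⟨_, continuous_comp_torusPoint hf hz⟩)
    (by rw [ContinuousMap.coe_mk, hA']; exact summable_zero) 0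
  rw [ContinuousMap.coe_mk, hA'] at this
  simp only [Pi.zero_apply, zero_smul] at this
  have h0 : torusPoint z 0 = z := by funext i; simp [torusPoint]
  simpa [h0] using this.unique hasSum_zero

lemma summable_monomial {n : ℕ} {r : ℝ} (hr : r ∈ Set.Ico (0 : ℝ) 1) :
    Summable fun k : Fin n → ℕ => r ^ ∑ i, k i := by
  classical
  refine summable_of_sum_le (c := ∏ _i : Fin n, (1 - r)⁻¹) (fun k => pow_nonneg hr.1 _) fun u => ?_
  obtain ⟨N, hN⟩ : ∃ N, u ⊆ Fintype.piFinset fun _ : Fin n => Finset.range N := by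
    refine ⟨u.sup (fun k => ∑ i, k i) + 1, fun k hk => ?_⟩
    rw [Fintype.mem_piFinset]
    intro i
    have h1 := Finset.le_sup (f := fun k : Fin n → ℕ => ∑ i, k i) hk
    have h2 := Finset.single_le_sum (f := k) (fun _ _ => Nat.zero_le _) (Finset.mem_univ i)
    rw [Finset.mem_range]
    beta_reduce at h1
    exact Nat.lt_succ_of_le (h2.trans h1)
  calc ∑ k ∈ u, r ^ ∑ i, k i ≤ ∑ k ∈ Fintype.piFinset fun _ : Fin n => Finset.range N,
        r ^ ∑ i, k i := Finset.sum_le_sum_of_subset_of_nonneg hN fun k _ _ => pow_nonneg hr.1 _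
    _ = ∏ _i : Fin n, ∑ j ∈ Finset.range N, r ^ j := by
        rw [Finset.prod_univ_sum]
        simp_rw [Finset.prod_pow_eq_pow_sum]
    _ ≤ _ := by
        refine Finset.prod_le_prod (fun _ _ => Finset.sum_nonneg fun _ _ => pow_nonneg hr.1 _)
          fun _ _ => ?_
        rw [← tsum_geometric_of_lt_one hr.1 hr.2]
        exact (summable_geometric_of_lt_one hr.1 hr.2).sum_le_tsum _ fun _ _ => pow_nonneg hr.1 _

lemma norm_monomial_le {n : ℕ} {z : Fin n → ℂ} {r : ℝ} (hz : ∀ i, ‖z i‖ ≤ r)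
    (k : Fin n → ℕ) : ‖∏ i, z i ^ k i‖ ≤ r ^ ∑ i, k i := by
  rw [norm_prod, ← Finset.prod_pow_eq_pow_sum]
  refine Finset.prod_le_prod (fun _ _ => norm_nonneg _) fun i _ => ?_
  rw [norm_pow]
  exact pow_le_pow_left₀ (norm_nonneg _) (hz i) _

lemma norm_lt_one {n : ℕ} {z : Fin n → ℂ} (hz : z ∈ polydisc n) : ‖z‖ < 1 :=
  (pi_norm_lt_iff one_pos).2 hz

lemma differentiable_monomial {n : ℕ} (k : Fin n → ℕ) :
    Differentiable ℂ fun z : Fin n → ℂ => ∏ i, z i ^ k i := by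
  fun_prop

lemma summable_powerSeries {n : ℕ} {a : (Fin n → ℕ) → ℂ} {C : ℝ} (ha : ∀ k, ‖a k‖ ≤ C)
    {z : Fin n → ℂ} (hz : z ∈ polydisc n) : Summable fun k => a k * ∏ i, z i ^ k i := by
  refine Summable.of_norm_bounded
    ((summable_monomial ⟨norm_nonneg z, norm_lt_one hz⟩).mul_left C) fun k => ?_
  rw [norm_mul]
  exact mul_le_mul (ha k) (norm_monomial_le (norm_le_pi_norm z) k) (norm_nonneg _)
    ((norm_nonneg _).trans (ha k))

lemma differentiableOn_powerSeries {n : ℕ} {a : (Fin n → ℕ) → ℂ} {C : ℝ} (ha : ∀ k, ‖a k‖ ≤ C) :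
    DifferentiableOn ℂ (fun z : Fin n → ℂ => ∑' k, a k * ∏ i, z i ^ k i) (polydisc n) := by
  intro z₀ hz₀
  have hC : 0 ≤ C := (norm_nonneg _).trans (ha 0)
  obtain ⟨r, h0r, hr1⟩ := exists_between (norm_lt_one hz₀)
  obtain ⟨R, hrR, hR1⟩ := exists_between hr1
  have hr0 : 0 ≤ r := (norm_nonneg _).trans h0r.le
  have hsub : ∀ z ∈ Metric.ball (0 : Fin n → ℂ) r, ∀ i, ‖z i‖ < r := fun z hz i =>
    (norm_le_pi_norm z i).trans_lt (by simpa using hz)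
  have hu : Summable fun k : Fin n → ℕ => (C * 2 / (R - r)) * R ^ ∑ i, k i :=
    (summable_monomial ⟨hr0.trans hrR.le, hR1⟩).mul_left _
  have hd : ∀ k : Fin n → ℕ, Differentiable ℂ fun z : Fin n → ℂ => a k * ∏ i, z i ^ k i :=
    fun k => (differentiable_monomial k).const_mul (a k)
  have hbd : ∀ (k : Fin n → ℕ), ∀ z ∈ Metric.ball (0 : Fin n → ℂ) r,
      ‖fderiv ℂ (fun z : Fin n → ℂ => a k * ∏ i, z i ^ k i) z‖ ≤
        (C * 2 / (R - r)) * R ^ ∑ i, k i := by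
    intro k z hz
    have hz' := hsub z hz
    have hb : ∀ y ∈ Metric.ball z (R - r), ‖a k * ∏ i, y i ^ k i‖ ≤ C * R ^ ∑ i, k i := by
      intro y hy
      rw [norm_mul]
      refine mul_le_mul (ha k) (norm_monomial_le (fun i => ?_) k) (norm_nonneg _) hC
      have h1 : ‖(y - z) i‖ < R - r :=
        (norm_le_pi_norm (y - z) i).trans_lt (by simpa [dist_eq_norm] using hy)
      have h2 := hz' i
      have h3 : ‖y i‖ ≤ ‖(y - z) i‖ + ‖z i‖ := by
        simpa using norm_add_le ((y - z) i) (z i)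
      linarith
    have hmaps : Set.MapsTo (fun z : Fin n → ℂ => a k * ∏ i, z i ^ k i) (Metric.ball z (R - r))
        (Metric.closedBall (a k * ∏ i, z i ^ k i) (2 * (C * R ^ ∑ i, k i))) := by
      intro y hy
      rw [Metric.mem_closedBall, dist_eq_norm]
      refine (norm_sub_le _ _).trans ?_
      have h1 := hb y hy
      have h2 := hb z (Metric.mem_ball_self (by linarith))
      linarith
    have hRr : 0 < R - r := by linarith
    have := Complex.norm_fderiv_le_div_of_mapsTo_ball (hd k).differentiableOn hmaps hRr
    refine this.trans (le_of_eq ?_)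
    ring
  have hz₁ : z₀ ∈ Metric.ball (0 : Fin n → ℂ) r := by simpa using h0r
  have key := hasFDerivAt_tsum_of_isPreconnected hu Metric.isOpen_ball
    (convex_ball (0 : Fin n → ℂ) r).isPreconnected
    (fun k z _ => (hd k z).hasFDerivAt) hbd hz₁ (summable_powerSeries ha hz₀) hz₁
  exact key.differentiableAt.differentiableWithinAt

lemma mFourier_int {n : ℕ} (k : Fin n → ℤ) :
    ∫ t, UnitAddTorus.mFourier k t ∂torusMeasure n = if k = 0 then 1 else 0 := by
  simp only [UnitAddTorus.mFourier, ContinuousMap.coe_mk, torusMeasure]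
  rw [integral_fintype_prod_eq_prod (fun i (x : UnitAddCircle) => fourier (k i) x)]
  simp_rw [fourier_int]
  split_ifs with h
  · subst h; simp
  · obtain ⟨i, hi⟩ := Function.ne_iff.mp h
    exact Finset.prod_eq_zero (Finset.mem_univ i) (if_neg hi)

lemma coeff_eq_of_hasSum {n : ℕ} {f : (Fin n → ℂ) → ℂ} {a : (Fin n → ℕ) → ℂ}
    (h : ∀ z ∈ polydisc n, HasSum (fun k => a k * ∏ i, z i ^ k i) (f z)) : coeff f = a := by
  funext k
  have hs := (h _ (half_mem n)).summable.norm
  have key := hasSum_integral_of_summable_integral_norm (μ := torusMeasure n)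
    (F := fun (j : Fin n → ℕ) t => UnitAddTorus.mFourier (-fun i => (k i : ℤ)) t *
      (a j * ∏ i, torusPoint (fun _ => 1 / 2) t i ^ j i)) ?_ ?_
  · have hg : ∀ t, ∑' j : Fin n → ℕ, UnitAddTorus.mFourier (-fun i => (k i : ℤ)) t *
      (a j * ∏ i, torusPoint (fun _ => 1 / 2) t i ^ j i) =
        UnitAddTorus.mFourier (-fun i => (k i : ℤ)) t * f (torusPoint (fun _ => 1 / 2) t) := by
      intro t
      rw [tsum_mul_left, (h _ (torusPoint_mem (half_mem n) t)).tsum_eq]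
    simp_rw [hg] at key
    have e : ∀ j : Fin n → ℕ, ∫ t, UnitAddTorus.mFourier (-fun i => (k i : ℤ)) t *
        (a j * ∏ i, torusPoint (fun _ => 1 / 2) t i ^ j i) ∂torusMeasure n =
        if j = k then a k * (1 / 2) ^ ∑ i, k i else 0 := by
      intro j
      have e1 : ∀ t, UnitAddTorus.mFourier (-fun i => (k i : ℤ)) t *
          (a j * ∏ i, torusPoint (fun _ => 1 / 2) t i ^ j i) = (a j * (1 / 2) ^ ∑ i, j i) *
          UnitAddTorus.mFourier ((-fun i => (k i : ℤ)) + fun i => (j i : ℤ)) t := by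
        intro t
        have e2 : UnitAddTorus.mFourier (fun i => (j i : ℤ)) t =
            ∏ i, (AddCircle.toCircle (t i) : ℂ) ^ j i := by
          simp [UnitAddTorus.mFourier, fourier_apply, AddCircle.toCircle_nsmul]
        rw [UnitAddTorus.mFourier_add, e2]
        simp only [torusPoint, mul_pow, Finset.prod_mul_distrib, Finset.prod_pow_eq_pow_sum]
        ring
      simp_rw [e1]
      rw [integral_const_mul, mFourier_int]
      by_cases hj : j = k
      · subst hj; simp
      · rw [if_neg hj, if_neg, mul_zero]
        intro h0
        apply hj
        apply cast_injective n
        exact (neg_add_eq_zero.1 h0).symm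
    simp_rw [e] at key
    have := key.unique (hasSum_ite_eq k (a k * (1 / 2) ^ ∑ i, k i))
    rw [coeff, torusCoeff, this, mul_assoc, ← mul_pow]
    norm_num
  · intro j
    refine integrable_of_continuous ?_
    have := (differentiable_monomial j).continuous.comp (continuous_torusPoint (fun _ : Fin n => (1 / 2 : ℂ)))
    exact (map_continuous _).mul (continuous_const.mul this)
  · refine hs.congr fun j => ?_
    simp [torusPoint, UnitAddTorus.mFourier, fourier_apply, Circle.norm_coe]

lemma continuous_sq {n : ℕ} {f : (Fin n → ℂ) → ℂ} (hf : DifferentiableOn ℂ f (polydisc n))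
    {r : ℝ} (hr : r ∈ Set.Ico (0 : ℝ) 1) :
    Continuous fun t => ‖f (torusPoint (fun _ => (r : ℂ)) t)‖ ^ 2 :=
  (continuous_comp_torusPoint hf (const_mem hr)).norm.pow 2

lemma sqMean_nonneg {n : ℕ} (f : (Fin n → ℂ) → ℂ) (r : ℝ) : 0 ≤ sqMean f r :=
  integral_nonneg fun _ => by positivity

lemma sqMean_mono {n : ℕ} {f g : (Fin n → ℂ) → ℂ} {c : ℝ} {r : ℝ} (hr : r ∈ Set.Ico (0 : ℝ) 1)
    (hf : DifferentiableOn ℂ f (polydisc n)) (hg : DifferentiableOn ℂ g (polydisc n))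
    (h : ∀ z ∈ polydisc n, ‖f z‖ ^ 2 ≤ c * ‖g z‖ ^ 2) : sqMean f r ≤ c * sqMean g r := by
  rw [sqMean, sqMean, ← integral_const_mul]
  exact integral_mono (integrable_of_continuous (continuous_sq hf hr))
    (integrable_of_continuous ((continuous_sq hg hr).const_mul c))
    fun t => h _ (torusPoint_mem (const_mem hr) t)

lemma sqMean_add_le {n : ℕ} {f g : (Fin n → ℂ) → ℂ} {r : ℝ} (hr : r ∈ Set.Ico (0 : ℝ) 1)
    (hf : DifferentiableOn ℂ f (polydisc n)) (hg : DifferentiableOn ℂ g (polydisc n)) :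
    sqMean (f + g) r ≤ 2 * sqMean f r + 2 * sqMean g r := by
  simp only [sqMean]
  rw [← integral_const_mul, ← integral_const_mul, ← integral_add]
  · refine integral_mono (integrable_of_continuous (continuous_sq (hf.add hg) hr))
      (integrable_of_continuous (((continuous_sq hf hr).const_mul 2).add
        ((continuous_sq hg hr).const_mul 2))) fun t => ?_
    have h1 := norm_add_le (f (torusPoint (fun _ => (r : ℂ)) t))
      (g (torusPoint (fun _ => (r : ℂ)) t))
    simp only [Pi.add_apply]
    nlinarith [sq_nonneg (‖f (torusPoint (fun _ => (r : ℂ)) t)‖ -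
      ‖g (torusPoint (fun _ => (r : ℂ)) t)‖), norm_nonneg (f (torusPoint (fun _ => (r : ℂ)) t) +
      g (torusPoint (fun _ => (r : ℂ)) t))]
  · exact integrable_of_continuous ((continuous_sq hf hr).const_mul 2)
  · exact integrable_of_continuous ((continuous_sq hg hr).const_mul 2)

/-- The holomorphic functions on the polydisc `𝔻ⁿ` with bounded integral means `∫ |f(r z)|² dθ`,
`0 ≤ r < 1`. A function on `𝔻ⁿ` is encoded by its extension by zero to `ℂⁿ`, so that two elements
are equal if and only if they agree on `𝔻ⁿ`. -/
def hardySubmodule (n : ℕ) : Submodule ℂ ((Fin n → ℂ) → ℂ) where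
  carrier := {f | DifferentiableOn ℂ f (polydisc n) ∧ (∀ z ∉ polydisc n, f z = 0) ∧
    BddAbove (sqMean f '' Set.Ico 0 1)}
  zero_mem' := by
    refine ⟨differentiableOn_const 0, fun _ _ => rfl, 0, ?_⟩
    rintro _ ⟨r, _, rfl⟩
    simp [sqMean]
  add_mem' := by
    rintro f g ⟨hf, hf0, A, hA⟩ ⟨hg, hg0, B, hB⟩
    refine ⟨hf.add hg, fun z hz => by simp [hf0 z hz, hg0 z hz], 2 * A + 2 * B, ?_⟩
    rintro _ ⟨r, hr, rfl⟩
    have h1 := hA ⟨r, hr, rfl⟩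
    have h2 := hB ⟨r, hr, rfl⟩
    have h3 := sqMean_add_le hr hf hg
    linarith
  smul_mem' := by
    rintro c f ⟨hf, hf0, A, hA⟩
    refine ⟨hf.const_smul c, fun z hz => by simp [hf0 z hz], ‖c‖ ^ 2 * A, ?_⟩
    rintro _ ⟨r, hr, rfl⟩
    refine (sqMean_mono hr (hf.const_smul c) hf fun z _ => ?_).trans
      (mul_le_mul_of_nonneg_left (hA ⟨r, hr, rfl⟩) (sq_nonneg ‖c‖))
    simp [mul_pow]

lemma bddAbove_of_summable {n : ℕ} {f : (Fin n → ℂ) → ℂ}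
    (hf : DifferentiableOn ℂ f (polydisc n)) (hs : Summable fun k => ‖coeff f k‖ ^ 2) :
    ∑' k, ‖coeff f k‖ ^ 2 ∈ upperBounds (sqMean f '' Set.Ico 0 1) := by
  rintro _ ⟨r, hr, rfl⟩
  exact hasSum_le (fun k => mul_le_of_le_one_right (sq_nonneg _) (pow_le_one₀ hr.1 hr.2.le))
    (hasSum_sqMean hf hr) hs.hasSum

lemma sum_le_of_mem_upperBounds {n : ℕ} {f : (Fin n → ℂ) → ℂ}
    (hf : DifferentiableOn ℂ f (polydisc n)) {C : ℝ}
    (hC : C ∈ upperBounds (sqMean f '' Set.Ico 0 1)) (u : Finset (Fin n → ℕ)) :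
    ∑ k ∈ u, ‖coeff f k‖ ^ 2 ≤ C := by
  have hc : Filter.Tendsto (fun r : ℝ => ∑ k ∈ u, ‖coeff f k‖ ^ 2 * r ^ (2 * ∑ i, k i))
      (nhdsWithin 1 (Set.Iio 1)) (nhds (∑ k ∈ u, ‖coeff f k‖ ^ 2)) := by
    have : Continuous fun r : ℝ => ∑ k ∈ u, ‖coeff f k‖ ^ 2 * r ^ (2 * ∑ i, k i) := by fun_prop
    have h2 := (this.tendsto 1).mono_left (nhdsWithin_le_nhds (s := Set.Iio 1))
    simpa using h2
  refine le_of_tendsto hc ?_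
  filter_upwards [Ico_mem_nhdsLT (zero_lt_one (α := ℝ))] with r hr
  refine (((hasSum_sqMean hf hr).summable.sum_le_tsum u fun k _ =>
    mul_nonneg (sq_nonneg _) (pow_nonneg hr.1 _))).trans ?_
  rw [(hasSum_sqMean hf hr).tsum_eq]
  exact hC ⟨r, hr, rfl⟩

lemma summable_of_bddAbove {n : ℕ} {f : (Fin n → ℂ) → ℂ}
    (hf : DifferentiableOn ℂ f (polydisc n)) (hb : BddAbove (sqMean f '' Set.Ico 0 1)) :
    Summable fun k => ‖coeff f k‖ ^ 2 := by
  obtain ⟨C, hC⟩ := hb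
  exact summable_of_sum_le (fun _ => sq_nonneg _) (sum_le_of_mem_upperBounds hf hC)

lemma sSup_sqMean {n : ℕ} {f : (Fin n → ℂ) → ℂ}
    (hf : DifferentiableOn ℂ f (polydisc n)) (hb : BddAbove (sqMean f '' Set.Ico 0 1)) :
    sSup (sqMean f '' Set.Ico 0 1) = ∑' k, ‖coeff f k‖ ^ 2 := by
  have hs := summable_of_bddAbove hf hb
  apply le_antisymm
  · exact csSup_le ⟨_, 0, by simp, rfl⟩ (bddAbove_of_summable hf hs)
  · exact hs.tsum_le_of_sum_le
      (sum_le_of_mem_upperBounds hf fun x hx => le_csSup hb hx)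

end Hardy

open Hardy

/-- The Hardy space `H²(𝔻ⁿ)`. -/
def HardySpace (n : ℕ) : Type := hardySubmodule n

namespace HardySpace

variable {n : ℕ}

instance : AddCommGroup (HardySpace n) := inferInstanceAs (AddCommGroup (hardySubmodule n))

instance : Module ℂ (HardySpace n) := inferInstanceAs (Module ℂ (hardySubmodule n))

instance : CoeFun (HardySpace n) fun _ => (Fin n → ℂ) → ℂ := ⟨fun f => Subtype.val f⟩

@[simp] lemma add_apply (f g : HardySpace n) (z : Fin n → ℂ) : (f + g) z = f z + g z := rfl

@[simp] lemma smul_apply (c : ℂ) (f : HardySpace n) (z : Fin n → ℂ) : (c • f) z = c * f z := rfl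

lemma ext {f g : HardySpace n} (h : ∀ z ∈ polydisc n, f z = g z) : f = g := by
  apply Subtype.ext
  funext z
  by_cases hz : z ∈ polydisc n
  · exact h z hz
  · exact (f.2.2.1 z hz).trans (g.2.2.1 z hz).symm

lemma torusCoeff_add {f g : (Fin n → ℂ) → ℂ} (hf : DifferentiableOn ℂ f (polydisc n))
    (hg : DifferentiableOn ℂ g (polydisc n)) {w : Fin n → ℂ} (hw : w ∈ polydisc n)
    (k : Fin n → ℤ) : torusCoeff (f + g) w k = torusCoeff f w k + torusCoeff g w k := by
  rw [torusCoeff, torusCoeff, torusCoeff, ← integral_add]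
  · simp [mul_add]
  · exact integrable_of_continuous ((map_continuous _).mul (continuous_comp_torusPoint hf hw))
  · exact integrable_of_continuous ((map_continuous _).mul (continuous_comp_torusPoint hg hw))

lemma torusCoeff_smul (c : ℂ) (f : (Fin n → ℂ) → ℂ) (w : Fin n → ℂ)
    (k : Fin n → ℤ) : torusCoeff (c • f) w k = c * torusCoeff f w k := by
  rw [torusCoeff, torusCoeff, ← integral_const_mul]
  congr 1
  funext t
  simp
  ring

/-- The sequence of Taylor coefficients at the origin, as an element of `ℓ²(ℕⁿ)`. -/
def taylor : HardySpace n →ₗ[ℂ] lp (fun _ : Fin n → ℕ => ℂ) 2 where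
  toFun f := ⟨coeff f, memℓp_gen (by simpa using summable_of_bddAbove f.2.1 f.2.2.2)⟩
  map_add' f g := by
    ext k
    change coeff (f.1 + g.1) k = coeff f k + coeff g k
    simp only [coeff, torusCoeff_add f.2.1 g.2.1 (half_mem n), add_mul]
  map_smul' c f := by
    ext k
    change coeff (c • f.1) k = c * coeff f k
    simp only [coeff, torusCoeff_smul, mul_assoc]

lemma taylor_apply (f : HardySpace n) (k : Fin n → ℕ) : taylor f k = coeff f k := rfl

/-- The norm is `(sup_{0 ≤ r < 1} ∫_{𝕋ⁿ} |f(r z)|² dθ)^{1/2}`. -/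
instance : Norm (HardySpace n) := ⟨fun f => √(sSup (sqMean f '' Set.Ico 0 1))⟩

lemma norm_def (f : HardySpace n) : ‖f‖ = √(sSup (sqMean f '' Set.Ico 0 1)) := rfl

lemma norm_eq_norm_taylor (f : HardySpace n) : ‖f‖ = ‖taylor f‖ := by
  rw [norm_def, sSup_sqMean f.2.1 f.2.2.2, Real.sqrt_eq_iff_mul_self_eq
    (tsum_nonneg fun _ => sq_nonneg _) (norm_nonneg _), ← pow_two]
  have := lp.norm_rpow_eq_tsum (p := 2) (by norm_num) (taylor f)
  simpa [taylor_apply] using this.symm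

lemma taylor_injective : Function.Injective (taylor (n := n)) := by
  rw [injective_iff_map_eq_zero]
  intro f hf
  refine ext fun z hz => eq_zero_of_coeff f.2.1 ?_ hz
  funext k
  exact congrArg (fun a : lp (fun _ : Fin n → ℕ => ℂ) 2 => a k) hf

/-- The normed group structure for the norm `(sup_{0 ≤ r < 1} ∫_{𝕋ⁿ} |f(r z)|² dθ)^{1/2}`. -/
instance : NormedAddCommGroup (HardySpace n) :=
  AddGroupNorm.toNormedAddCommGroup
    { toFun := fun f => ‖f‖
      map_zero' := by rw [norm_eq_norm_taylor, map_zero, norm_zero]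
      add_le' := fun f g => by
        simp only [norm_eq_norm_taylor, map_add]; exact norm_add_le _ _
      neg' := fun f => by simp only [norm_eq_norm_taylor, map_neg, norm_neg]
      eq_zero_of_map_eq_zero' := fun f hf => by
        rw [norm_eq_norm_taylor, norm_eq_zero] at hf
        exact taylor_injective (hf.trans (map_zero _).symm) }

/-- The inner product that induces the norm. -/
instance : InnerProductSpace ℂ (HardySpace n) where
  norm_smul_le c f := by simp only [norm_eq_norm_taylor, map_smul]; exact norm_smul_le _ _
  inner f g := inner ℂ (taylor f) (taylor g)
  norm_sq_eq_re_inner f := by rw [norm_eq_norm_taylor]; exact norm_sq_eq_re_inner _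
  conj_inner_symm f g := inner_conj_symm _ _
  add_left f g h := by rw [map_add, inner_add_left]
  smul_left f g c := by rw [map_smul, inner_smul_left]

lemma inner_def (f g : HardySpace n) : inner ℂ f g = inner ℂ (taylor f) (taylor g) := rfl

lemma taylor_surjective : Function.Surjective (taylor (n := n)) := by
  classical
  intro a
  have ha : ∀ k, ‖a k‖ ≤ ‖a‖ := fun k => lp.norm_apply_le_norm (by norm_num) a k
  set F : (Fin n → ℂ) → ℂ := fun z => ∑' k, a k * ∏ i, z i ^ k i with hF
  have hFd : DifferentiableOn ℂ F (polydisc n) := differentiableOn_powerSeries ha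
  set f : (Fin n → ℂ) → ℂ := (polydisc n).indicator F with hf
  have hfF : ∀ z ∈ polydisc n, f z = F z := fun z hz => Set.indicator_of_mem hz F
  have hfd : DifferentiableOn ℂ f (polydisc n) := hFd.congr hfF
  have hc : coeff f = a := coeff_eq_of_hasSum fun z hz => by
    rw [hfF z hz]
    exact (summable_powerSeries ha hz).hasSum
  have hs : Summable fun k => ‖coeff f k‖ ^ 2 := by
    rw [hc]
    have := (lp.memℓp a).summable (by norm_num)
    simpa using this
  refine ⟨⟨f, hfd, fun z hz => Set.indicator_of_notMem hz F,
    _, bddAbove_of_summable hfd hs⟩, ?_⟩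
  ext k
  exact congrFun hc k

/-- `H²(𝔻ⁿ)` is isometrically isomorphic to `ℓ²(ℕⁿ)` through the Taylor coefficients. -/
def taylorEquiv (n : ℕ) : HardySpace n ≃ₗᵢ[ℂ] lp (fun _ : Fin n → ℕ => ℂ) 2 where
  toLinearEquiv := LinearEquiv.ofBijective taylor ⟨taylor_injective, taylor_surjective⟩
  norm_map' f := (norm_eq_norm_taylor f).symm

/-- `H²(𝔻ⁿ)` is a Hilbert space. -/
instance : CompleteSpace (HardySpace n) :=
  (completeSpace_congr (e := (taylorEquiv n).toLinearEquiv.toEquiv)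
    (taylorEquiv n).isometry.isUniformEmbedding).2 inferInstance

lemma bddAbove_mul_coord (i : Fin n) (f : HardySpace n) :
    sSup (sqMean f '' Set.Ico 0 1) ∈
      upperBounds (sqMean (fun z => z i * f z) '' Set.Ico 0 1) := by
  rintro _ ⟨r, hr, rfl⟩
  have hd : DifferentiableOn ℂ (fun z : Fin n → ℂ => z i * f z) (polydisc n) :=
    DifferentiableOn.mul (by fun_prop) f.2.1
  have h1 := sqMean_mono (c := 1) hr hd f.2.1 fun z hz => by
    rw [norm_mul, mul_pow]
    exact mul_le_mul_of_nonneg_right (pow_le_one₀ (norm_nonneg _) (hz i).le) (sq_nonneg _)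
  rw [one_mul] at h1
  exact h1.trans (le_csSup f.2.2.2 ⟨r, hr, rfl⟩)

/-- The multiplication operator `M_{z_i}` by the `i`-th coordinate function. -/
def shift (i : Fin n) : HardySpace n →L[ℂ] HardySpace n :=
  LinearMap.mkContinuous
    { toFun := fun f => ⟨fun z => z i * f z, DifferentiableOn.mul (by fun_prop) f.2.1,
        fun z hz => by simp [f.2.2.1 z hz], _, bddAbove_mul_coord i f⟩
      map_add' := fun f g => ext fun z _ => mul_add (z i) (f z) (g z)
      map_smul' := fun c f => ext fun z _ => mul_left_comm (z i) c (f z) }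
    1 fun f => by
      rw [one_mul]
      exact Real.sqrt_le_sqrt (csSup_le ⟨_, 0, by simp, rfl⟩ (bddAbove_mul_coord i f))

@[simp] lemma shift_apply (i : Fin n) (f : HardySpace n) (z : Fin n → ℂ) :
    shift i f z = z i * f z := rfl

lemma sqMean_one_eq (g : (Fin 1 → ℂ) → ℂ) (r : ℝ) :
    sqMean g r = ∫ s : UnitAddCircle, ‖g fun _ => r * (AddCircle.toCircle s : ℂ)‖ ^ 2
      ∂AddCircle.haarAddCircle := by
  have h := integral_fintype_prod_eq_prod (ι := Fin 1) (𝕜 := ℝ) (E := fun _ => UnitAddCircle)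
    (μ := fun _ => AddCircle.haarAddCircle)
    fun _ s => ‖g fun _ => r * (AddCircle.toCircle s : ℂ)‖ ^ 2
  simp only [Finset.univ_unique, Finset.prod_singleton] at h
  rw [← h, sqMean, torusMeasure]
  congr 1
  funext t
  congr 3
  funext j
  rw [Subsingleton.elim j default]
  rfl

lemma sqMean_prod (f : Fin n → HardySpace 1) (r : ℝ) :
    sqMean (fun z : Fin n → ℂ => ∏ i, f i fun _ => z i) r = ∏ i, sqMean (f i) r := by
  simp_rw [sqMean_one_eq]
  rw [sqMean, torusMeasure, ← integral_fintype_prod_eq_prod]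
  simp [torusPoint, Finset.prod_pow]

/-- The elementary tensor `f₁ ⊗ ⋯ ⊗ fₙ` of functions on the disc, seen in the Hardy space of the
polydisc: the function `(z₁, …, zₙ) ↦ f₁(z₁) ⋯ fₙ(zₙ)`. -/
def tensor (f : Fin n → HardySpace 1) : HardySpace n :=
  ⟨fun z => ∏ i, f i fun _ => z i, by
    refine ⟨?_, ?_, ∏ i, sSup (sqMean (f i) '' Set.Ico 0 1), ?_⟩
    · have hd : ∀ i, DifferentiableOn ℂ (fun z : Fin n → ℂ => f i fun _ => z i) (polydisc n) :=
        fun i => (f i).2.1.comp (t := polydisc 1) (by fun_prop) fun z hz _ => hz i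
      exact fun z hz => (HasFDerivWithinAt.finsetProd (u := Finset.univ)
        fun i _ => (hd i z hz).hasFDerivWithinAt).differentiableWithinAt
    · intro z hz
      obtain ⟨i, hi⟩ : ∃ i, ¬ ‖z i‖ < 1 := by simpa [polydisc] using hz
      exact Finset.prod_eq_zero (Finset.mem_univ i) ((f i).2.2.1 _ fun h => hi (h 0))
    · rintro _ ⟨r, hr, rfl⟩
      rw [sqMean_prod]
      exact Finset.prod_le_prod (fun _ _ => sqMean_nonneg _ _) fun i _ =>
        le_csSup (f i).2.2.2 ⟨r, hr, rfl⟩⟩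

lemma torusCoeff_one (g : (Fin 1 → ℂ) → ℂ) (w : ℂ) (k : ℤ) :
    torusCoeff g (fun _ => w) (fun _ => k) = ∫ s : UnitAddCircle,
      fourier (-k) s * g (fun _ => w * (AddCircle.toCircle s : ℂ)) ∂AddCircle.haarAddCircle := by
  have h := integral_fintype_prod_eq_prod (ι := Fin 1) (𝕜 := ℂ) (E := fun _ => UnitAddCircle)
    (μ := fun _ => AddCircle.haarAddCircle)
    fun _ s => fourier (-k) s * g (fun _ => w * (AddCircle.toCircle s : ℂ))
  simp only [Finset.univ_unique, Finset.prod_singleton] at h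
  rw [← h, torusCoeff, torusMeasure]
  congr 1
  funext t
  congr 1
  · simp [UnitAddTorus.mFourier]
  · congr 1
    funext j
    rw [Subsingleton.elim j default]
    rfl

/-- The Taylor coefficients of an elementary tensor are the products of the Taylor coefficients
of its factors; in particular `z^{l₁} ⊗ ⋯ ⊗ z^{lₙ}` is the monomial `z₁^{l₁} ⋯ zₙ^{lₙ}`. -/
lemma coeff_tensor (f : Fin n → HardySpace 1) (k : Fin n → ℕ) :
    coeff (tensor f) k = ∏ i, coeff (f i) fun _ => k i := by
  simp only [coeff, torusCoeff_one, Finset.prod_mul_distrib, Finset.univ_unique,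
    Finset.sum_singleton, Finset.prod_pow_eq_pow_sum]
  congr 1
  rw [torusCoeff, torusMeasure, ← integral_fintype_prod_eq_prod]
  simp only [Finset.prod_mul_distrib]
  rfl

lemma tensor_apply (f : Fin n → HardySpace 1) (z : Fin n → ℂ) :
    tensor f z = ∏ i, f i fun _ => z i := rfl

/-- The Hilbert space tensor product `S₁ ⊗ ⋯ ⊗ Sₙ` of subspaces of the Hardy space of the disc, as
a closed subspace of the Hardy space of the polydisc: the closed linear span of the elementary
tensors `f₁ ⊗ ⋯ ⊗ fₙ` with `fᵢ ∈ Sᵢ`. -/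
def hilbertTensor (S : Fin n → Submodule ℂ (HardySpace 1)) : Submodule ℂ (HardySpace n) :=
  (Submodule.span ℂ
    {F | ∃ f : Fin n → HardySpace 1, (∀ i, f i ∈ S i) ∧ F = tensor f}).topologicalClosure

end HardySpace

/-- A quotient module of `H²(𝔻ⁿ)`: a closed subspace whose orthogonal complement is invariant
under all the multiplication operators `M_{z_i}`. -/
structure QuotientModule (n : ℕ) extends ClosedSubmodule ℂ (HardySpace n) where
  shift_mem_orthogonal : ∀ (i : Fin n), ∀ f ∈ toSubmoduleᗮ, HardySpace.shift i f ∈ toSubmoduleᗮ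

namespace QuotientModule

variable {n : ℕ}

instance (Q : QuotientModule n) : CompleteSpace Q.toSubmodule :=
  Q.isClosed'.completeSpace_coe

/-- The compression `C_{z_i} = P_Q M_{z_i}|_Q`. -/
def compression (Q : QuotientModule n) (i : Fin n) : Q.toSubmodule →L[ℂ] Q.toSubmodule :=
  Q.toSubmodule.orthogonalProjectionOnto ∘L HardySpace.shift i ∘L Q.toSubmodule.subtypeL

/-- A quotient module is doubly commuting if `C_{z_i} C_{z_j}^* = C_{z_j}^* C_{z_i}` for `i ≠ j`. -/
def IsDoublyCommuting (Q : QuotientModule n) : Prop :=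
  ∀ i j : Fin n, i ≠ j →
    Q.compression i ∘L ContinuousLinearMap.adjoint (Q.compression j) =
      ContinuousLinearMap.adjoint (Q.compression j) ∘L Q.compression i

end QuotientModule

end

/-!
Write `P` for the projection onto a quotient module `Q`, `C i` for the compression of `M_{z_i}`, and
`η = P 1`.

*Tensor products are doubly commuting.* The projection onto `Q₁ ⊗ ⋯ ⊗ Qₙ` acts factor by factor on
elementary tensors (`starProjection_hilbertTensor`), and so do `M_{z_i}` and `M_{z_j}^*`. Since `Q`
is invariant under `M_{z_j}^*`, the operator `(C j)^*` is a restriction of it, so `C i` and `(C j)^*`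
act on different factors when `i ≠ j`.

*Doubly commuting quotient modules are tensor products.* The defect operators
`D i = 1 - C i (C i)^*` commute, and their product is the compression of the projection onto the
constants, hence the rank one operator `η ⊗ η` (`IsDoublyCommuting.defect_mul_coDefect`). Such a
factorization of a rank one operator makes the vector functional of `η` multiplicative, up to
normalization, over the different coordinates (`inner_mul_inner_of_rankOne_factor`). As
`P z^k = C^k η`, the matrix entries `⟪z^m, P z^k⟫ = ⟪C^m η, C^k η⟫` are therefore, up to
a constant, products of one-variable matrices `⟪(C i)^{m_i} η, (C i)^{k_i} η⟫`
(`IsDoublyCommuting.inner_prod_compression_pow`).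

The one-variable matrix of the `i`-th coordinate is that of `Vᵢ^* P Vᵢ`, where `Vᵢ f = f(z_i)`. The
range projection of `Vᵢ` is the product of the `1 - M_{z_j} M_{z_j}^*` with `j ≠ i`, whose compression
`∏_{j ≠ i} D j` has `η`, and then every `(C i)^p η`, as an eigenvector. So the square of `Vᵢ^* P Vᵢ`
is a multiple of itself, and `Vᵢ^* P Vᵢ` is a multiple of the projection onto a subspace `Qᵢ`, the
orthogonal complement of the functions `f` with `f(z_i) ⊥ Q`
(`IsDoublyCommuting.exists_inner_proj_coordEmbedding`). It follows that `P` is a multiple of the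
projection onto `Q₁ ⊗ ⋯ ⊗ Qₙ`, and so the two ranges agree.
-/

noncomputable section

open Hardy InnerProductSpace

/-! ### Taylor coefficients and monomials -/

/-- A product of absolutely convergent series is the series of the products. -/
lemma hasSum_pi_prod {n : ℕ} (a : Fin n → ℕ → ℂ) (ha : ∀ i, Summable fun l => ‖a i l‖) :
    (Summable fun k : Fin n → ℕ => ‖∏ i, a i (k i)‖) ∧
      HasSum (fun k : Fin n → ℕ => ∏ i, a i (k i)) (∏ i, ∑' l, a i l) := by
  induction n with
  | zero =>
    refine ⟨(hasSum_fintype _).summable, ?_⟩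
    simp
  | succ n ih =>
    obtain ⟨h1, h2⟩ := ih (fun i => a i.succ) fun i => ha _
    have e : ∀ p : ℕ × (Fin n → ℕ), ∏ i, a i (Fin.consEquiv (fun _ => ℕ) p i) =
        a 0 p.1 * ∏ i, a i.succ (p.2 i) := fun p => by
      simp [Fin.prod_univ_succ, Fin.consEquiv]
    constructor
    · rw [← (Fin.consEquiv fun _ : Fin (n + 1) => ℕ).summable_iff]
      refine (Summable.mul_norm (ha 0) h1).congr fun p => ?_
      exact congrArg norm (e p).symm
    · rw [← (Fin.consEquiv fun _ : Fin (n + 1) => ℕ).hasSum_iff, Fin.prod_univ_succ]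
      have hs := summable_mul_of_summable_norm (ha 0) h1
      refine ((ha 0).of_norm.hasSum.mul h2 hs).congr_fun fun p => ?_
      exact e p

namespace HardySpace

variable {n : ℕ}

lemma ext_coeff {f g : HardySpace n} (h : ∀ k, coeff f k = coeff g k) : f = g :=
  taylor_injective (by ext k; exact h k)

/-- The monomial `z₁^{k₁} ⋯ zₙ^{kₙ}`, given by its Taylor coefficients. -/
def monomial (k : Fin n → ℕ) : HardySpace n :=
  (taylorEquiv n).symm (lp.single 2 k 1)

lemma inner_eq_tsum (f g : HardySpace n) :
    ⟪f, g⟫_ℂ = ∑' k, coeff g k * starRingEnd ℂ (coeff f k) := by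
  rw [inner_def, lp.inner_eq_tsum]
  simp [taylor_apply]

lemma taylor_monomial (k : Fin n → ℕ) : taylor (monomial k) = lp.single 2 k 1 :=
  (taylorEquiv n).apply_symm_apply _

lemma coeff_monomial (k m : Fin n → ℕ) : coeff (monomial k) m = if m = k then 1 else 0 := by
  rw [← taylor_apply, taylor_monomial, lp.single_apply, Pi.single_apply]

lemma inner_monomial (k : Fin n → ℕ) (f : HardySpace n) : ⟪monomial k, f⟫_ℂ = coeff f k := by
  rw [inner_def, taylor_monomial, lp.inner_single_left]
  simp [taylor_apply]

/-- A bounded operator on `H²(𝔻ⁿ)` is determined by its values at the monomials. -/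
lemma clm_ext {E : Type*} [NormedAddCommGroup E] [InnerProductSpace ℂ E] [CompleteSpace E]
    {A B : HardySpace n →L[ℂ] E} (h : ∀ k, A (monomial k) = B (monomial k)) : A = B := by
  rw [← ContinuousLinearMap.adjoint.injective.eq_iff]
  ext1 x
  refine ext_coeff fun k => ?_
  rw [← inner_monomial, ← inner_monomial, ContinuousLinearMap.adjoint_inner_right,
    ContinuousLinearMap.adjoint_inner_right, h]

lemma torusCoeff_mul_coord (f : (Fin n → ℂ) → ℂ) (i : Fin n) (w : Fin n → ℂ) (k : Fin n → ℤ) :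
    torusCoeff (fun z => z i * f z) w k = w i * torusCoeff f w (k - Pi.single i 1) := by
  rw [torusCoeff, torusCoeff, ← integral_const_mul]
  congr 1
  funext t
  have h : UnitAddTorus.mFourier (Pi.single i 1) t = (AddCircle.toCircle (t i) : ℂ) := by
    rw [UnitAddTorus.mFourier_single]; simp
  rw [neg_sub, sub_eq_neg_add, UnitAddTorus.mFourier_add, h, torusPoint]
  ring

lemma coeff_shift_of_eq_zero (i : Fin n) (f : HardySpace n) {k : Fin n → ℕ} (hk : k i = 0) :
    coeff (shift i f) k = 0 := by
  change coeff (fun z => z i * f z) k = 0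
  rw [coeff, torusCoeff_mul_coord, torusCoeff_eq_zero f.2.1 (half_mem n) _ i (by simp [hk])]
  simp

lemma coeff_shift_add (i : Fin n) (f : HardySpace n) (k : Fin n → ℕ) :
    coeff (shift i f) (k + Pi.single i 1) = coeff f k := by
  change coeff (fun z => z i * f z) (k + Pi.single i 1) = coeff f k
  have e : (fun j => (((k + Pi.single i 1 : Fin n → ℕ) j : ℕ) : ℤ)) - Pi.single i 1 =
      fun j => (k j : ℤ) := by
    funext j
    rcases eq_or_ne j i with rfl | hj
    · simp
    · simp [hj]
  rw [coeff, coeff, torusCoeff_mul_coord, e]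
  simp [Finset.sum_add_distrib, pow_succ]
  ring

lemma exists_eq_add_single {k : Fin n → ℕ} {i : Fin n} (hk : k i ≠ 0) :
    ∃ l : Fin n → ℕ, k = l + Pi.single i 1 := by
  refine ⟨k - Pi.single i 1, (tsub_add_cancel_of_le fun j => ?_).symm⟩
  rcases eq_or_ne j i with rfl | hj
  · rw [Pi.single_eq_same]
    exact Nat.pos_of_ne_zero hk
  · simp [hj]

lemma shift_monomial (i : Fin n) (k : Fin n → ℕ) :
    shift i (monomial k) = monomial (k + Pi.single i 1) := by
  refine ext_coeff fun m => ?_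
  rcases Nat.eq_zero_or_pos (m i) with hm | hm
  · rw [coeff_shift_of_eq_zero i _ hm, coeff_monomial, if_neg]
    rintro rfl
    simp at hm
  · obtain ⟨l, rfl⟩ := exists_eq_add_single hm.ne'
    simp [coeff_shift_add, coeff_monomial]

lemma coeff_adjoint_shift (i : Fin n) (f : HardySpace n) (k : Fin n → ℕ) :
    coeff (ContinuousLinearMap.adjoint (shift i) f) k = coeff f (k + Pi.single i 1) := by
  rw [← inner_monomial, ContinuousLinearMap.adjoint_inner_right, shift_monomial, inner_monomial]

lemma shift_comm (i j : Fin n) (f : HardySpace n) :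
    shift i (shift j f) = shift j (shift i f) :=
  ext fun z _ => mul_left_comm (z i) (z j) (f z)

/-! ### Inner products and shifts of elementary tensors -/

lemma tensor_monomial (k : Fin n → ℕ) : tensor (fun i => monomial fun _ => k i) = monomial k := by
  refine ext_coeff fun m => ?_
  rw [coeff_tensor]
  simp only [coeff_monomial, Finset.prod_ite_zero, Finset.prod_const_one, funext_iff]
  simp

lemma inner_one_eq_tsum (f g : HardySpace 1) :
    ⟪f, g⟫_ℂ = ∑' l : ℕ, coeff g (fun _ => l) * starRingEnd ℂ (coeff f fun _ => l) := by
  rw [inner_eq_tsum, ← (Equiv.funUnique (Fin 1) ℕ).symm.tsum_eq]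
  rfl

/-- Inner products of elementary tensors are the products of the inner products of the factors. -/
lemma inner_tensor (f g : Fin n → HardySpace 1) :
    ⟪tensor f, tensor g⟫_ℂ = ∏ i, ⟪f i, g i⟫_ℂ := by
  have hs : ∀ i, Summable fun l : ℕ =>
      ‖coeff (g i) (fun _ => l) * starRingEnd ℂ (coeff (f i) fun _ => l)‖ := fun i => by
    have := (lp.summable_inner (𝕜 := ℂ) (taylor (f i)) (taylor (g i))).norm
    rw [← (Equiv.funUnique (Fin 1) ℕ).symm.summable_iff] at this
    refine this.congr fun l => ?_
    simp [taylor_apply, mul_comm]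
    rfl
  have h := (hasSum_pi_prod _ hs).2.tsum_eq
  rw [inner_eq_tsum]
  simp_rw [inner_one_eq_tsum]
  rw [← h]
  simp [coeff_tensor, Finset.prod_mul_distrib]

lemma shift_tensor (i : Fin n) (f : Fin n → HardySpace 1) :
    shift i (tensor f) = tensor (Function.update f i (shift 0 (f i))) := by
  refine ext fun z _ => ?_
  rw [shift_apply, tensor_apply, tensor_apply, ← Finset.mul_prod_erase _ _ (Finset.mem_univ i),
    ← Finset.mul_prod_erase _ (fun j => Function.update f i (shift 0 (f i)) j fun _ => z j)
      (Finset.mem_univ i), Function.update_self, shift_apply, mul_assoc]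
  congr 2
  refine Finset.prod_congr rfl fun j hj => ?_
  rw [Function.update_of_ne (Finset.ne_of_mem_erase hj)]

/-- The backward shift `M_{z_i}^*` acts on the `i`-th factor of an elementary tensor. -/
lemma adjoint_shift_tensor (i : Fin n) (f : Fin n → HardySpace 1) :
    ContinuousLinearMap.adjoint (shift i) (tensor f) =
      tensor (Function.update f i (ContinuousLinearMap.adjoint (shift 0) (f i))) := by
  refine ext_coeff fun k => ?_
  rw [coeff_adjoint_shift, coeff_tensor, coeff_tensor]
  refine Finset.prod_congr rfl fun j _ => ?_
  rcases eq_or_ne j i with rfl | hj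
  · rw [Function.update_self, coeff_adjoint_shift]
    congr 1
    funext l
    rw [Subsingleton.elim l 0]
    simp
  · simp [hj]

end HardySpace

/-! ### Tensor products of quotient modules are doubly commuting -/

namespace HardySpace

variable {n : ℕ}

instance (S : Fin n → Submodule ℂ (HardySpace 1)) : CompleteSpace (hilbertTensor S) :=
  (Submodule.isClosed_topologicalClosure _).completeSpace_coe

lemma tensor_mem_hilbertTensor {S : Fin n → Submodule ℂ (HardySpace 1)} {f : Fin n → HardySpace 1}
    (hf : ∀ i, f i ∈ S i) : tensor f ∈ hilbertTensor S :=
  Submodule.le_topologicalClosure _ (Submodule.subset_span ⟨f, hf, rfl⟩)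

lemma hilbertTensor_le {S : Fin n → Submodule ℂ (HardySpace 1)} {U : Submodule ℂ (HardySpace n)}
    (hU : IsClosed (U : Set (HardySpace n))) (h : ∀ f, (∀ i, f i ∈ S i) → tensor f ∈ U) :
    hilbertTensor S ≤ U := by
  refine Submodule.topologicalClosure_minimal _ (Submodule.span_le.2 ?_) hU
  rintro _ ⟨f, hf, rfl⟩
  exact h f hf

/-- The orthogonal projection onto `S₁ ⊗ ⋯ ⊗ Sₙ` is the tensor product of the orthogonal
projections onto the factors. -/
lemma starProjection_hilbertTensor (S : Fin n → Submodule ℂ (HardySpace 1))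
    [∀ i, (S i).HasOrthogonalProjection] (g : Fin n → HardySpace 1) :
    (hilbertTensor S).starProjection (tensor g) = tensor fun i => (S i).starProjection (g i) := by
  refine Submodule.eq_starProjection_of_mem_orthogonal
    (tensor_mem_hilbertTensor fun i => Submodule.starProjection_apply_mem (S i) (g i)) ?_
  have h : hilbertTensor S ≤
      (ℂ ∙ (tensor g - tensor fun i => (S i).starProjection (g i)))ᗮ := by
    refine hilbertTensor_le (Submodule.isClosed_orthogonal _) fun f hf => ?_
    rw [Submodule.mem_orthogonal_singleton_iff_inner_left, inner_sub_right, inner_tensor,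
      inner_tensor, sub_eq_zero]
    refine Finset.prod_congr rfl fun i _ => ?_
    rw [← Submodule.inner_starProjection_left_eq_right, Submodule.starProjection_eq_self_iff.2 (hf i)]
  rw [Submodule.mem_orthogonal]
  intro u hu
  exact Submodule.mem_orthogonal_singleton_iff_inner_left.1 (h hu)

end HardySpace

namespace QuotientModule

open HardySpace

variable {n : ℕ} (Q : QuotientModule n)

lemma adjoint_shift_mem (i : Fin n) {f : HardySpace n} (hf : f ∈ Q.toSubmodule) :
    ContinuousLinearMap.adjoint (shift i) f ∈ Q.toSubmodule := by
  rw [← Submodule.orthogonal_orthogonal Q.toSubmodule, Submodule.mem_orthogonal]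
  intro u hu
  rw [ContinuousLinearMap.adjoint_inner_right, Submodule.inner_left_of_mem_orthogonal hf
    (Q.shift_mem_orthogonal i u hu)]

lemma coe_compression (i : Fin n) (f : Q.toSubmodule) :
    (Q.compression i f : HardySpace n) = Q.toSubmodule.starProjection (shift i f) := rfl

/-- The adjoint of the compression is the restriction of the backward shift, because `Q` is
invariant under the latter. -/
lemma coe_adjoint_compression (i : Fin n) (f : Q.toSubmodule) :
    (ContinuousLinearMap.adjoint (Q.compression i) f : HardySpace n) =
      ContinuousLinearMap.adjoint (shift i) (f : HardySpace n) := by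
  have h : ContinuousLinearMap.adjoint (Q.compression i) f =
      ⟨_, Q.adjoint_shift_mem i f.2⟩ := by
    refine ext_inner_right ℂ fun g => ?_
    rw [ContinuousLinearMap.adjoint_inner_left, Submodule.coe_inner, Submodule.coe_inner,
      coe_compression, ← Submodule.inner_starProjection_left_eq_right,
      Submodule.starProjection_eq_self_iff.2 f.2, ContinuousLinearMap.adjoint_inner_left]
  rw [h]

lemma isDoublyCommuting_of_eq_hilbertTensor (q : Fin n → QuotientModule 1)
    (h : Q.toSubmodule = hilbertTensor fun i => (q i).toSubmodule) : Q.IsDoublyCommuting := by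
  intro i j hij
  have hP : ∀ g, Q.toSubmodule.starProjection (tensor g) =
      tensor fun i => (q i).toSubmodule.starProjection (g i) := by
    simpa only [h] using starProjection_hilbertTensor fun i => (q i).toSubmodule
  have key : Q.toSubmodule ≤ LinearMap.eqLocus
      (Q.toSubmodule.starProjection ∘L shift i ∘L
        ContinuousLinearMap.adjoint (shift j)).toLinearMap
      (ContinuousLinearMap.adjoint (shift j) ∘L
        Q.toSubmodule.starProjection ∘L shift i).toLinearMap := by
    refine h.trans_le (hilbertTensor_le
      (isClosed_eq (ContinuousLinearMap.continuous _) (ContinuousLinearMap.continuous _))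
      fun f hf => ?_)
    simp only [LinearMap.mem_eqLocus, ContinuousLinearMap.coe_coe,
      ContinuousLinearMap.comp_apply, adjoint_shift_tensor, shift_tensor, hP]
    congr 1
    funext l
    rcases eq_or_ne l i with rfl | hl
    · simp [hij]
    · rcases eq_or_ne l j with rfl | hl'
      · simp only [Function.update_of_ne hl, Function.update_self]
        rw [Submodule.starProjection_eq_self_iff.2 (hf l),
          Submodule.starProjection_eq_self_iff.2 ((q l).adjoint_shift_mem 0 (hf l))]
      · simp [hl, hl']
  ext1 f
  apply Subtype.ext
  have := key f.2
  simpa [coe_compression, coe_adjoint_compression] using this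

end QuotientModule

/-! ### Doubly commuting operators with defect of rank one -/

/-- If a rank one positive operator `η ⊗ η` factors as `D D' = D' D`, then the vector functional of
`η` is multiplicative, up to normalization, on products `A B` where `A` commutes with `D'` and `B`
commutes with `D`. -/
lemma inner_mul_inner_of_rankOne_factor {E : Type*} [NormedAddCommGroup E] [InnerProductSpace ℂ E]
    (η : E) {D D' A B : E →L[ℂ] E} (h : ∀ x, (D * D') x = ⟪η, x⟫_ℂ • η) (hD : Commute D D')
    (hA : Commute A D') (hB : Commute B D) :
    ⟪η, A η⟫_ℂ * ⟪η, B η⟫_ℂ = ⟪η, η⟫_ℂ * ⟪η, (A * B) η⟫_ℂ := by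
  rcases eq_or_ne η 0 with rfl | hη
  · simp
  have hc : ⟪η, η⟫_ℂ ≠ 0 := inner_self_ne_zero.2 hη
  set R := D * D' with hR
  have hRR : R * R = ⟪η, η⟫_ℂ • R := by
    ext x
    simp [h, smul_smul, mul_comm]
  -- Both `R A R R B R` and `R A B R` reduce to `D A R^p B D'`, with `p = 3` and `p = 1`.
  have h1 : R * A * R * R * B * R = D * A * (R * R * R) * B * D' := by
    calc R * A * R * R * B * R = D * (D' * A) * R * R * (B * D) * D' := by
          rw [hR]; simp only [mul_assoc]
      _ = D * A * ((D' * D) * (D' * D) * (D' * D)) * B * D' := by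
          rw [← hA.eq, hB.eq, hR]; simp only [mul_assoc]
      _ = _ := by rw [← hD.eq]
  have h2 : R * A * B * R = D * A * R * B * D' := by
    calc R * A * B * R = D * (D' * A) * (B * D) * D' := by
          rw [hR]; simp only [mul_assoc]
      _ = D * A * (D' * D) * B * D' := by
          rw [← hA.eq, hB.eq]; simp only [mul_assoc]
      _ = _ := by rw [← hD.eq]
  have h3 : R * A * R * R * B * R = (⟪η, η⟫_ℂ * ⟪η, η⟫_ℂ) • (R * A * B * R) := by
    rw [h1, h2, hRR, smul_mul_assoc, hRR]
    simp [smul_smul]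
  have h4 := congrArg (fun T : E →L[ℂ] E => ⟪η, T η⟫_ℂ) h3
  simp only [mul_apply_eq_comp, smul_apply, h, map_smul,
    inner_smul_right] at h4
  simp only [mul_apply_eq_comp]
  apply mul_left_cancel₀ (pow_ne_zero 3 hc)
  linear_combination h4

/-- For doubly commuting operators `C i` whose defect operators have a rank one product `η ⊗ η`, the
Gram matrix of the vectors `∏ i, C i ^ k i` applied to `η` is, up to normalization, the product of
the Gram matrices of the vectors `C i ^ p` applied to `η`. The operator `D' i` stands for the
product of the defect operators with index different from `i`. -/
lemma inner_prod_pow_of_doublyCommuting {ι E : Type*} [NormedAddCommGroup E]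
    [InnerProductSpace ℂ E] [CompleteSpace E] (η : E) {C D' : ι → E →L[ℂ] E}
    (hC : ∀ i j, Commute (C i) (C j)) (hC' : ∀ i j, i ≠ j → Commute (C i) (star (C j)))
    (hD : ∀ i x, ((1 - C i * star (C i)) * D' i) x = ⟪η, x⟫_ℂ • η)
    (hCD : ∀ i, Commute (C i) (D' i)) (hCD' : ∀ i, Commute (star (C i)) (D' i))
    {l : List ι} (hl : l.Nodup) (k m : ι → ℕ) :
    ⟪η, η⟫_ℂ ^ l.length *
      ⟪(l.map fun i => C i ^ k i).prod η, (l.map fun i => C i ^ m i).prod η⟫_ℂ =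
    ⟪η, η⟫_ℂ * (l.map fun i => ⟪(C i ^ k i) η, (C i ^ m i) η⟫_ℂ).prod := by
  induction l with
  | nil => simp
  | cons i l ih =>
    rw [List.nodup_cons] at hl
    have hne : ∀ j ∈ l, j ≠ i := fun j hj h => hl.1 (h ▸ hj)
    have h1 : ∀ p : ι → ℕ, Commute (l.map fun j => C j ^ p j).prod (C i) := fun p => by
      refine Commute.list_prod_left _ _ ?_
      simp only [List.forall_mem_map]
      exact fun j _ => (hC j i).pow_left _
    have h2 : ∀ p : ι → ℕ, Commute (l.map fun j => C j ^ p j).prod (star (C i)) := fun p => by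
      refine Commute.list_prod_left _ _ ?_
      simp only [List.forall_mem_map]
      exact fun j hj => (hC' j i (hne j hj)).pow_left _
    set X := (l.map fun j => C j ^ k j).prod
    set Y := (l.map fun j => C j ^ m j).prod
    have h3 : Commute (star X) (C i) := by
      have := (h2 k).star_star
      rwa [star_star] at this
    have h4 : Commute (star X) (star (C i)) := (h1 k).star_star
    have hB : Commute (star X * Y) (1 - C i * star (C i)) :=
      (Commute.one_right _).sub_right
        ((h3.mul_left (h1 m)).mul_right (h4.mul_left (h2 m)))
    have hA : Commute (star (C i) ^ k i * C i ^ m i) (D' i) :=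
      ((hCD' i).pow_left _).mul_left ((hCD i).pow_left _)
    have key := inner_mul_inner_of_rankOne_factor η (hD i)
      ((Commute.one_left _).sub_left ((hCD i).mul_left (hCD' i))) hA hB
    have hst : ∀ (A B : E →L[ℂ] E) (q : E), ⟪q, (star A * B) q⟫_ℂ = ⟪A q, B q⟫_ℂ :=
      fun A B q => by
        rw [mul_apply_eq_comp, ContinuousLinearMap.star_eq_adjoint,
          ContinuousLinearMap.adjoint_inner_right]
    have e : star (C i) ^ k i * C i ^ m i * (star X * Y) =
        star (C i ^ k i * X) * (C i ^ m i * Y) := by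
      have h5 : Commute (star X) (star (C i) ^ k i * C i ^ m i) :=
        (h4.pow_right _).mul_right (h3.pow_right _)
      rw [star_mul, star_pow, ← mul_assoc, ← h5.eq]
      simp only [mul_assoc]
    rw [e, hst, hst, ← star_pow, hst] at key
    simp only [List.map_cons, List.prod_cons, List.length_cons]
    rw [pow_succ, mul_assoc, ← key]
    linear_combination ⟪(C i ^ k i) η, (C i ^ m i) η⟫_ℂ * ih hl.2

/-! ### Functions of a single coordinate in the Hardy space -/

namespace HardySpace

variable {n : ℕ}

lemma coeff_sub (f g : HardySpace n) (k : Fin n → ℕ) :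
    coeff (f - g : HardySpace n) k = coeff f k - coeff g k := by
  simp [← taylor_apply]

lemma coeff_smul (c : ℂ) (f : HardySpace n) (k : Fin n → ℕ) :
    coeff (c • f : HardySpace n) k = c * coeff f k := by
  simp [← taylor_apply]

lemma commute_star_shift {i j : Fin n} (hij : i ≠ j) : Commute (star (shift i)) (shift j) := by
  ext1 f
  refine ext_coeff fun k => ?_
  simp only [mul_apply_eq_comp, ContinuousLinearMap.star_eq_adjoint,
    coeff_adjoint_shift]
  rcases Nat.eq_zero_or_pos (k j) with hk | hk
  · rw [coeff_shift_of_eq_zero j _ hk, coeff_shift_of_eq_zero]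
    simp [hk, hij.symm]
  · obtain ⟨l, rfl⟩ := exists_eq_add_single hk.ne'
    rw [coeff_shift_add, add_right_comm, coeff_shift_add, coeff_adjoint_shift]

/-- The projection `1 - M_{z_i} M_{z_i}^*` onto the functions that do not depend on `z_i`. -/
def wandering (i : Fin n) : HardySpace n →L[ℂ] HardySpace n := 1 - shift i * star (shift i)

lemma coeff_wandering (i : Fin n) (f : HardySpace n) (k : Fin n → ℕ) :
    coeff (wandering i f) k = if k i = 0 then coeff f k else 0 := by
  simp only [wandering, sub_apply, one_apply_eq_self,
    mul_apply_eq_comp, ContinuousLinearMap.star_eq_adjoint, coeff_sub]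
  split_ifs with hk
  · rw [coeff_shift_of_eq_zero i _ hk, sub_zero]
  · obtain ⟨l, rfl⟩ := exists_eq_add_single hk
    rw [coeff_shift_add, coeff_adjoint_shift, sub_self]

lemma coeff_prod_wandering (l : List (Fin n)) (f : HardySpace n) (k : Fin n → ℕ) :
    coeff ((l.map wandering).prod f) k = if ∀ i ∈ l, k i = 0 then coeff f k else 0 := by
  induction l with
  | nil => simp
  | cons i l ih =>
    rw [List.map_cons, List.prod_cons, mul_apply_eq_comp, coeff_wandering, ih]
    simp [ite_and]

lemma shift_pow_monomial (i : Fin n) (p : ℕ) (k : Fin n → ℕ) :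
    (shift i ^ p) (monomial k) = monomial (Pi.single i p + k) := by
  induction p with
  | zero => simp
  | succ p ih =>
    rw [pow_succ', mul_apply_eq_comp, ih, shift_monomial, add_right_comm,
      ← Pi.single_add]

lemma prod_shift_pow_monomial (l : List (Fin n)) (k m : Fin n → ℕ) :
    (l.map fun i => shift i ^ k i).prod (monomial m) =
      monomial ((l.map fun i => Pi.single i (k i)).sum + m) := by
  induction l with
  | nil => simp
  | cons i l ih =>
    rw [List.map_cons, List.prod_cons, mul_apply_eq_comp, ih, shift_pow_monomial,
      List.map_cons, List.sum_cons, add_assoc]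

lemma monomial_eq_prod_shift_pow (k : Fin n → ℕ) :
    monomial k = (Finset.univ.toList.map fun i => shift i ^ k i).prod (monomial 0) := by
  rw [prod_shift_pow_monomial, Finset.sum_map_toList, Finset.univ_sum_single, add_zero]

lemma tensor_update_apply (g : Fin n → HardySpace 1) (i : Fin n) (f : HardySpace 1)
    (z : Fin n → ℂ) : tensor (Function.update g i f) z =
      f (fun _ => z i) * ∏ j ∈ Finset.univ.erase i, g j fun _ => z j := by
  rw [tensor_apply, ← Finset.mul_prod_erase _ _ (Finset.mem_univ i), Function.update_self]
  congr 1
  refine Finset.prod_congr rfl fun j hj => ?_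
  rw [Function.update_of_ne (Finset.ne_of_mem_erase hj)]

/-- The isometry `H²(𝔻) → H²(𝔻ⁿ)` that sends `f` to the function `z ↦ f(z_i)`, that is to
`1 ⊗ ⋯ ⊗ f ⊗ ⋯ ⊗ 1`. -/
def coordEmbedding (i : Fin n) : HardySpace 1 →ₗᵢ[ℂ] HardySpace n :=
  LinearMap.isometryOfInner
    { toFun := fun f => tensor (Function.update (fun _ => monomial 0) i f)
      map_add' := fun f g => ext fun z _ => by simp [tensor_update_apply, add_mul]
      map_smul' := fun c f => ext fun z _ => by simp [tensor_update_apply, mul_assoc] }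
    fun f g => by
      simp only [LinearMap.coe_mk, AddHom.coe_mk]
      rw [inner_tensor, Finset.prod_eq_single i]
      · simp
      · intro j _ hj
        rw [Function.update_of_ne hj, Function.update_of_ne hj, inner_monomial, coeff_monomial,
          if_pos rfl]
      · simp

lemma coordEmbedding_apply (i : Fin n) (f : HardySpace 1) :
    coordEmbedding i f = tensor (Function.update (fun _ => monomial 0) i f) := rfl

lemma shift_coordEmbedding (i : Fin n) (f : HardySpace 1) :
    shift i (coordEmbedding i f) = coordEmbedding i (shift 0 f) := by
  simp [coordEmbedding_apply, shift_tensor]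

lemma coordEmbedding_monomial (i : Fin n) (m : Fin 1 → ℕ) :
    coordEmbedding i (monomial m) = monomial (Pi.single i (m 0)) := by
  rw [coordEmbedding_apply, ← tensor_monomial (Pi.single i (m 0))]
  congr 1
  funext j
  rcases eq_or_ne j i with rfl | hj
  · simp only [Function.update_self, Pi.single_eq_same]
    congr 1
    funext l
    rw [Subsingleton.elim l 0]
  · simp only [Function.update_of_ne hj, Pi.single_eq_of_ne hj]
    rfl

lemma coeff_coordEmbedding (i : Fin n) (f : HardySpace 1) (k : Fin n → ℕ) :
    coeff (coordEmbedding i f) k =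
      if ∀ j ∈ (Finset.univ.erase i).toList, k j = 0 then coeff f fun _ => k i else 0 := by
  rw [coordEmbedding_apply, coeff_tensor, ← Finset.mul_prod_erase _ _ (Finset.mem_univ i),
    Function.update_self]
  have : ∀ j ∈ Finset.univ.erase i, coeff (Function.update (fun _ => monomial 0) i f j :
      HardySpace 1) (fun _ => k j) = if k j = 0 then 1 else 0 := fun j hj => by
    rw [Function.update_of_ne (Finset.ne_of_mem_erase hj), coeff_monomial]
    simp [funext_iff]
  rw [Finset.prod_congr rfl this, Finset.prod_ite_zero]
  simp

/-- The range projection of the embedding `f ↦ f(z_i)` is the product of the projections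
`1 - M_{z_j} M_{z_j}^*`, `j ≠ i`. -/
lemma coordEmbedding_adjoint (i : Fin n) (h : HardySpace n) :
    coordEmbedding i (ContinuousLinearMap.adjoint
      (coordEmbedding i).toContinuousLinearMap h) =
      ((Finset.univ.erase i).toList.map wandering).prod h := by
  refine ext_coeff fun k => ?_
  rw [coeff_coordEmbedding, coeff_prod_wandering]
  split_ifs with hk
  · rw [← inner_monomial, ContinuousLinearMap.adjoint_inner_right,
      LinearIsometry.coe_toContinuousLinearMap, coordEmbedding_monomial, inner_monomial]
    congr 1
    funext j
    rcases eq_or_ne j i with rfl | hj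
    · simp
    · simp [hj, hk j]
  · rfl

end HardySpace

/-! ### The defect operators of a doubly commuting quotient module -/

namespace QuotientModule

open HardySpace

variable {n : ℕ} (Q : QuotientModule n)

/-- The orthogonal projection `H²(𝔻ⁿ) → Q`, with values in `Q`. -/
abbrev proj : HardySpace n →L[ℂ] Q.toSubmodule := Q.toSubmodule.orthogonalProjectionOnto

/-- The projection of the constant function `1` to `Q`. -/
def projOne : Q.toSubmodule := Q.proj (monomial 0)

lemma inner_proj_right (q : Q.toSubmodule) (f : HardySpace n) :
    ⟪q, Q.proj f⟫_ℂ = ⟪(q : HardySpace n), f⟫_ℂ :=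
  Submodule.inner_orthogonalProjectionOnto_eq_of_mem_left q f

lemma inner_proj_left (f : HardySpace n) (q : Q.toSubmodule) :
    ⟪Q.proj f, q⟫_ℂ = ⟪f, (q : HardySpace n)⟫_ℂ :=
  Submodule.inner_orthogonalProjectionOnto_eq_of_mem_right q f

/-- The projection to `Q` intertwines `M_{z_i}` with its compression. -/
lemma proj_shift (i : Fin n) (f : HardySpace n) :
    Q.proj (shift i f) = Q.compression i (Q.proj f) := by
  refine ext_inner_left ℂ fun q => ?_
  rw [inner_proj_right, ← ContinuousLinearMap.adjoint_inner_left,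
    ← ContinuousLinearMap.adjoint_inner_left, ← coe_adjoint_compression, inner_proj_right]

lemma proj_prod_shift_pow (l : List (Fin n)) (k : Fin n → ℕ) (f : HardySpace n) :
    Q.proj ((l.map fun i => shift i ^ k i).prod f) =
      (l.map fun i => Q.compression i ^ k i).prod (Q.proj f) := by
  have hp : ∀ (i : Fin n) (p : ℕ) (f : HardySpace n),
      Q.proj ((shift i ^ p) f) = (Q.compression i ^ p) (Q.proj f) := by
    intro i p
    induction p with
    | zero => simp
    | succ p ih =>
      intro f
      rw [pow_succ', pow_succ', mul_apply_eq_comp, mul_apply_eq_comp, proj_shift, ih]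
  induction l with
  | nil => simp
  | cons i l ih =>
    simp only [List.map_cons, List.prod_cons, mul_apply_eq_comp, hp, ih]

lemma proj_monomial (k : Fin n → ℕ) : Q.proj (monomial k) =
    (Finset.univ.toList.map fun i => Q.compression i ^ k i).prod Q.projOne := by
  rw [monomial_eq_prod_shift_pow, proj_prod_shift_pow, projOne]

lemma compression_commute (i j : Fin n) : Commute (Q.compression i) (Q.compression j) := by
  ext1 q
  have h : ∀ i j, Q.compression i (Q.compression j q) =
      Q.proj (shift i (shift j (q : HardySpace n))) := fun i j => by
    rw [proj_shift, proj_shift, Submodule.orthogonalProjectionOnto_mem_subspace_eq_self]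
  rw [mul_apply_eq_comp, mul_apply_eq_comp, h, h, shift_comm]

/-- The defect operator `1 - C_{z_i} C_{z_i}^*`. -/
def defect (i : Fin n) : Q.toSubmodule →L[ℂ] Q.toSubmodule :=
  1 - Q.compression i * star (Q.compression i)

/-- The product of the defect operators of all coordinates but the `i`-th. -/
def coDefect (i : Fin n) : Q.toSubmodule →L[ℂ] Q.toSubmodule :=
  ((Finset.univ.erase i).toList.map Q.defect).prod

variable {Q}

lemma IsDoublyCommuting.commute_star (hQ : Q.IsDoublyCommuting) {i j : Fin n} (hij : i ≠ j) :
    Commute (Q.compression i) (star (Q.compression j)) := hQ i j hij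

/-- An operator that commutes with `C_{z_j}` and `C_{z_j}^*` commutes with the defect operator. -/
lemma commute_defect {A : Q.toSubmodule →L[ℂ] Q.toSubmodule} {j : Fin n}
    (h1 : Commute A (Q.compression j)) (h2 : Commute A (star (Q.compression j))) :
    Commute A (Q.defect j) :=
  (Commute.one_right A).sub_right (h1.mul_right h2)

lemma IsDoublyCommuting.compression_commute_defect (hQ : Q.IsDoublyCommuting) {i j : Fin n}
    (hij : i ≠ j) : Commute (Q.compression i) (Q.defect j) :=
  commute_defect (Q.compression_commute i j) (hQ.commute_star hij)

lemma IsDoublyCommuting.star_compression_commute_defect (hQ : Q.IsDoublyCommuting) {i j : Fin n}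
    (hij : i ≠ j) : Commute (star (Q.compression i)) (Q.defect j) :=
  commute_defect (hQ.commute_star hij.symm).symm (Q.compression_commute i j).star_star

lemma IsDoublyCommuting.compression_commute_coDefect (hQ : Q.IsDoublyCommuting) (i : Fin n) :
    Commute (Q.compression i) (Q.coDefect i) := by
  refine Commute.list_prod_right _ _ ?_
  simp only [List.forall_mem_map, Finset.mem_toList, Finset.mem_erase]
  exact fun j hj => hQ.compression_commute_defect hj.1.symm

lemma IsDoublyCommuting.star_compression_commute_coDefect (hQ : Q.IsDoublyCommuting) (i : Fin n) :
    Commute (star (Q.compression i)) (Q.coDefect i) := by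
  refine Commute.list_prod_right _ _ ?_
  simp only [List.forall_mem_map, Finset.mem_toList, Finset.mem_erase]
  exact fun j hj => hQ.star_compression_commute_defect hj.1.symm

lemma IsDoublyCommuting.defect_commute_coDefect (hQ : Q.IsDoublyCommuting) (i : Fin n) :
    Commute (Q.defect i) (Q.coDefect i) :=
  (Commute.one_left _).sub_left
    ((hQ.compression_commute_coDefect i).mul_left (hQ.star_compression_commute_coDefect i))

/-- Products of defect operators are the compressions of the corresponding products of the
projections `1 - M_{z_i} M_{z_i}^*`. -/
lemma IsDoublyCommuting.prod_defect_apply (hQ : Q.IsDoublyCommuting) {l : List (Fin n)}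
    (hl : l.Nodup) (q : Q.toSubmodule) :
    (l.map Q.defect).prod q = Q.proj ((l.map wandering).prod (q : HardySpace n)) := by
  induction l generalizing q with
  | nil => simp
  | cons i l ih =>
    rw [List.nodup_cons] at hl
    have h1 : Commute (star (Q.compression i)) (l.map Q.defect).prod := by
      refine Commute.list_prod_right _ _ ?_
      simp only [List.forall_mem_map]
      exact fun j hj => hQ.star_compression_commute_defect fun h => hl.1 (h ▸ hj)
    have h2 : Commute (star (shift i)) (l.map wandering).prod := by
      refine Commute.list_prod_right _ _ ?_
      simp only [List.forall_mem_map]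
      intro j hj
      have hij : i ≠ j := fun h => hl.1 (h ▸ hj)
      have hs : Commute (shift i) (shift j) := by
        ext1 f
        exact shift_comm i j f
      exact (Commute.one_right _).sub_right ((commute_star_shift hij).mul_right hs.star_star)
    have e1 := congrArg (fun T => T q) h1.eq
    have e2 := congrArg (fun T => T (q : HardySpace n)) h2.eq
    simp only [mul_apply_eq_comp] at e1 e2
    rw [List.map_cons, List.map_cons, List.prod_cons, List.prod_cons, mul_apply_eq_comp,
      mul_apply_eq_comp, defect, wandering, sub_apply, sub_apply, map_sub, one_apply_eq_self,
      one_apply_eq_self, mul_apply_eq_comp, mul_apply_eq_comp, e1, e2, proj_shift, ih hl.2,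
      ih hl.2, ContinuousLinearMap.star_eq_adjoint, ContinuousLinearMap.star_eq_adjoint,
      coe_adjoint_compression]

/-- The product of all defect operators is the rank one operator `q ↦ ⟪P_Q 1, q⟫ P_Q 1`. -/
lemma IsDoublyCommuting.defect_mul_coDefect (hQ : Q.IsDoublyCommuting) (i : Fin n)
    (q : Q.toSubmodule) : (Q.defect i * Q.coDefect i) q = ⟪Q.projOne, q⟫_ℂ • Q.projOne := by
  have h := hQ.prod_defect_apply (l := i :: (Finset.univ.erase i).toList)
    (by simp [Finset.nodup_toList]) q
  have e : ((i :: (Finset.univ.erase i).toList).map wandering).prod (q : HardySpace n) =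
      ⟪Q.projOne, q⟫_ℂ • monomial 0 := by
    refine ext_coeff fun k => ?_
    rw [coeff_prod_wandering, coeff_smul, coeff_monomial, projOne, inner_proj_left, inner_monomial]
    have : (∀ j ∈ i :: (Finset.univ.erase i).toList, k j = 0) ↔ k = 0 := by
      simp only [List.mem_cons, Finset.mem_toList, Finset.mem_erase, Finset.mem_univ, and_true,
        funext_iff, Pi.zero_apply]
      exact forall_congr' fun j => by simp [em]
    simp only [this]
    split_ifs with hk
    · rw [hk, mul_one]
    · rw [mul_zero]
  rw [e, map_smul] at h
  exact h

/-- The Gram matrix of the vectors `C^k P_Q 1` is, up to normalization, the product of the Gram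
matrices of the vectors `C_{z_i}^p P_Q 1`. -/
lemma IsDoublyCommuting.inner_prod_compression_pow (hQ : Q.IsDoublyCommuting) {l : List (Fin n)}
    (hl : l.Nodup) (k m : Fin n → ℕ) :
    ⟪Q.projOne, Q.projOne⟫_ℂ ^ l.length *
      ⟪(l.map fun i => Q.compression i ^ k i).prod Q.projOne,
        (l.map fun i => Q.compression i ^ m i).prod Q.projOne⟫_ℂ =
    ⟪Q.projOne, Q.projOne⟫_ℂ * (l.map fun i => ⟪(Q.compression i ^ k i) Q.projOne,
        (Q.compression i ^ m i) Q.projOne⟫_ℂ).prod :=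
  inner_prod_pow_of_doublyCommuting Q.projOne Q.compression_commute
    (fun _ _ hij => hQ.commute_star hij) hQ.defect_mul_coDefect
    hQ.compression_commute_coDefect hQ.star_compression_commute_coDefect hl k m

end QuotientModule

/-! ### The tensor factors of a doubly commuting quotient module -/

namespace QuotientModule

open HardySpace

variable {n : ℕ} (Q : QuotientModule n)

/-- The functions of one variable `f` such that `f(z_i)` is orthogonal to `Q`. -/
def sliceOrthogonal (i : Fin n) : Submodule ℂ (HardySpace 1) :=
  Q.toSubmoduleᗮ.comap (coordEmbedding i).toLinearMap

variable {Q} in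
lemma mem_sliceOrthogonal {i : Fin n} {f : HardySpace 1} :
    f ∈ Q.sliceOrthogonal i ↔ Q.proj (coordEmbedding i f) = 0 := by
  rw [Submodule.orthogonalProjectionOnto_eq_zero_iff]
  rfl

lemma isClosed_sliceOrthogonal (i : Fin n) :
    IsClosed (Q.sliceOrthogonal i : Set (HardySpace 1)) :=
  (Submodule.isClosed_orthogonal _).preimage (coordEmbedding i).continuous

instance (i : Fin n) : CompleteSpace (Q.sliceOrthogonal i) :=
  (Q.isClosed_sliceOrthogonal i).completeSpace_coe

/-- The `i`-th tensor factor of a doubly commuting quotient module: its orthogonal complement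
consists of the functions `f` such that `f(z_i)` is orthogonal to `Q`. -/
def slice (i : Fin n) : QuotientModule 1 where
  toSubmodule := (Q.sliceOrthogonal i)ᗮ
  isClosed' := Submodule.isClosed_orthogonal _
  shift_mem_orthogonal := by
    intro j f hf
    rw [Submodule.orthogonal_orthogonal] at hf ⊢
    rw [mem_sliceOrthogonal] at hf ⊢
    rw [Subsingleton.elim j 0, ← shift_coordEmbedding, proj_shift, hf, map_zero]

variable {Q}

lemma proj_coordEmbedding_monomial (i : Fin n) (m : Fin 1 → ℕ) :
    Q.proj (coordEmbedding i (monomial m)) = (Q.compression i ^ m 0) Q.projOne := by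
  have h := Q.proj_prod_shift_pow [i] (fun _ => m 0) (monomial 0)
  simp only [List.map_cons, List.map_nil, List.prod_cons, List.prod_nil, mul_one] at h
  rw [coordEmbedding_monomial, projOne, ← h, shift_pow_monomial, add_zero]

/-- The operator `∏_{j ≠ i} (1 - C_{z_j} C_{z_j}^*)` has `P_Q 1` as an eigenvector and commutes with
`C_{z_i}`, so it acts as a scalar on the projections to `Q` of the functions of `z_i`. -/
lemma IsDoublyCommuting.exists_coDefect_eq_smul (hQ : Q.IsDoublyCommuting) (hη : Q.projOne ≠ 0)
    (i : Fin n) : ∃ μ : ℂ, ∀ f,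
      Q.coDefect i (Q.proj (coordEmbedding i f)) = μ • Q.proj (coordEmbedding i f) := by
  have hc : ⟪Q.projOne, Q.projOne⟫_ℂ ≠ 0 := inner_self_ne_zero.2 hη
  -- The rank one operator `η ⊗ η` commutes with the codefect operator.
  have h1 : ⟪Q.projOne, Q.projOne⟫_ℂ • Q.coDefect i Q.projOne =
      ⟪Q.projOne, Q.coDefect i Q.projOne⟫_ℂ • Q.projOne := by
    rw [← hQ.defect_mul_coDefect i, ← map_smul, ← hQ.defect_mul_coDefect i, ← mul_apply_eq_comp,
      ← mul_apply_eq_comp, ← mul_assoc, (hQ.defect_commute_coDefect i).eq]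
  refine ⟨(⟪Q.projOne, Q.projOne⟫_ℂ)⁻¹ * ⟪Q.projOne, Q.coDefect i Q.projOne⟫_ℂ, fun f => ?_⟩
  set μ := (⟪Q.projOne, Q.projOne⟫_ℂ)⁻¹ * ⟪Q.projOne, Q.coDefect i Q.projOne⟫_ℂ with hμ
  have h2 : Q.coDefect i Q.projOne = μ • Q.projOne := by
    rw [hμ, mul_smul, ← h1, inv_smul_smul₀ hc]
  have h3 : Q.coDefect i ∘L Q.proj ∘L (coordEmbedding i).toContinuousLinearMap =
      μ • (Q.proj ∘L (coordEmbedding i).toContinuousLinearMap) := by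
    refine clm_ext fun m => ?_
    simp only [ContinuousLinearMap.comp_apply, _root_.smul_apply,
      LinearIsometry.coe_toContinuousLinearMap, proj_coordEmbedding_monomial]
    rw [← mul_apply_eq_comp, ← ((hQ.compression_commute_coDefect i).pow_left _).eq,
      mul_apply_eq_comp, h2, map_smul]
  exact congrArg (fun T => T f) h3

/-- The compression of `P_Q` to the functions of `z_i` is a multiple of the projection to the
`i`-th tensor factor. -/
lemma IsDoublyCommuting.exists_inner_proj_coordEmbedding (hQ : Q.IsDoublyCommuting)
    (hη : Q.projOne ≠ 0) (i : Fin n) : ∃ μ : ℂ, ∀ f g,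
      ⟪Q.proj (coordEmbedding i f), Q.proj (coordEmbedding i g)⟫_ℂ =
        μ * ⟪f, (Q.slice i).toSubmodule.starProjection g⟫_ℂ := by
  obtain ⟨μ, hμ⟩ := hQ.exists_coDefect_eq_smul hη i
  set V := (coordEmbedding (n := n) i).toContinuousLinearMap with hV
  set B : HardySpace 1 → HardySpace 1 := fun g =>
    ContinuousLinearMap.adjoint V (Q.proj (coordEmbedding i g) : HardySpace n) with hB
  have hinner : ∀ f g, ⟪f, B g⟫_ℂ =
      ⟪Q.proj (coordEmbedding i f), Q.proj (coordEmbedding i g)⟫_ℂ := fun f g => by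
    rw [hB, ContinuousLinearMap.adjoint_inner_right, inner_proj_left]
    rfl
  have hproj : ∀ g, Q.proj (coordEmbedding i (B g)) = μ • Q.proj (coordEmbedding i g) :=
    fun g => by
      rw [hB, hV, coordEmbedding_adjoint, ← hQ.prod_defect_apply (Finset.nodup_toList _)]
      exact hμ g
  -- On the tensor factor, `B u - μ u` lies both in the orthogonal complement and in the factor.
  have hfac : ∀ u ∈ (Q.slice i).toSubmodule, B u = μ • u := by
    intro u hu
    rw [← sub_eq_zero]
    have h1 : B u - μ • u ∈ Q.sliceOrthogonal i := by
      rw [mem_sliceOrthogonal, map_sub, map_sub, hproj, map_smul, map_smul, sub_self]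
    have h2 : B u - μ • u ∈ (Q.sliceOrthogonal i)ᗮ := by
      refine Submodule.sub_mem _ ?_ (Submodule.smul_mem _ _ hu)
      rw [Submodule.mem_orthogonal]
      intro f hf
      rw [hinner, mem_sliceOrthogonal.1 hf, inner_zero_left]
    exact inner_self_eq_zero.1 (Submodule.inner_right_of_mem_orthogonal h1 h2)
  refine ⟨μ, fun f g => ?_⟩
  have hg : g - (Q.slice i).toSubmodule.starProjection g ∈ Q.sliceOrthogonal i := by
    have h := Submodule.sub_starProjection_mem_orthogonal (K := (Q.slice i).toSubmodule) g
    have e : (Q.slice i).toSubmoduleᗮ = Q.sliceOrthogonal i := Submodule.orthogonal_orthogonal _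
    rwa [e] at h
  rw [mem_sliceOrthogonal, map_sub, map_sub, sub_eq_zero] at hg
  rw [hg, ← hinner, hfac _ (Submodule.starProjection_apply_mem _ _), inner_smul_right]

/-- A doubly commuting quotient module is the tensor product of its slices. -/
lemma IsDoublyCommuting.eq_hilbertTensor (hQ : Q.IsDoublyCommuting) (hn : 1 ≤ n) :
    Q.toSubmodule = hilbertTensor fun i => (Q.slice i).toSubmodule := by
  by_cases hη : Q.projOne = 0
  -- Here `Q = 0`, all slices are zero, and `n ≥ 1` ensures that a product of them is zero.
  · have hbot : Q.toSubmodule = ⊥ := by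
      have h0 : Q.proj = 0 := clm_ext fun k => by
        rw [proj_monomial, hη, map_zero, zero_apply]
      rw [Submodule.eq_bot_iff]
      intro x hx
      have := Submodule.orthogonalProjectionOnto_mem_subspace_eq_self (⟨x, hx⟩ : Q.toSubmodule)
      rw [show Q.toSubmodule.orthogonalProjectionOnto = 0 from h0] at this
      exact congrArg Subtype.val this.symm
    rw [hbot, eq_comm, eq_bot_iff]
    refine hilbertTensor_le (by simp) fun f hf => ?_
    have hf0 : f ⟨0, hn⟩ = 0 := by
      refine inner_self_eq_zero.1 (Submodule.inner_right_of_mem_orthogonal ?_ (hf ⟨0, hn⟩))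
      rw [mem_sliceOrthogonal, Submodule.orthogonalProjectionOnto_eq_zero_iff, hbot]
      simp
    rw [Submodule.mem_bot, ← inner_self_eq_zero (𝕜 := ℂ), inner_tensor]
    exact Finset.prod_eq_zero (Finset.mem_univ ⟨0, hn⟩) (by rw [hf0, inner_zero_left])
  have hc : ⟪Q.projOne, Q.projOne⟫_ℂ ≠ 0 := inner_self_ne_zero.2 hη
  choose μ hμ using hQ.exists_inner_proj_coordEmbedding hη
  set T := hilbertTensor fun i => (Q.slice i).toSubmodule
  have hT : ∀ k, T.starProjection (monomial k) =
      tensor fun i => (Q.slice i).toSubmodule.starProjection (monomial fun _ => k i) := fun k => by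
    rw [← tensor_monomial k]
    exact starProjection_hilbertTensor _ _
  set κ : ℂ := (⟪Q.projOne, Q.projOne⟫_ℂ ^ n)⁻¹ * (⟪Q.projOne, Q.projOne⟫_ℂ * ∏ i, μ i) with hκ
  -- Both sides have the same matrix entries, as products of the one-variable entries.
  have key : Q.toSubmodule.starProjection = κ • T.starProjection := by
    refine clm_ext fun k => ext_coeff fun m => ?_
    have h1 := hQ.inner_prod_compression_pow (Finset.nodup_toList Finset.univ) m k
    rw [← proj_monomial, ← proj_monomial, inner_proj_left, inner_monomial,
      Finset.length_toList, Finset.card_univ, Fintype.card_fin, Finset.prod_map_toList] at h1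
    have h2 : ∀ i, ⟪(Q.compression i ^ m i) Q.projOne, (Q.compression i ^ k i) Q.projOne⟫_ℂ =
        μ i * coeff ((Q.slice i).toSubmodule.starProjection (monomial fun _ => k i))
          fun _ => m i := fun i => by
      rw [← inner_monomial, ← hμ, proj_coordEmbedding_monomial, proj_coordEmbedding_monomial]
    simp only [h2, Finset.prod_mul_distrib] at h1
    rw [_root_.smul_apply, coeff_smul, hT, coeff_tensor, hκ, mul_assoc, mul_assoc, ← h1,
      inv_mul_cancel_left₀ (pow_ne_zero _ hc)]
    rfl
  have hκ0 : κ ≠ 0 := by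
    intro h
    rw [h, zero_smul] at key
    apply hη
    apply Subtype.ext
    exact congrArg (fun A => A (monomial 0)) key
  apply le_antisymm
  · intro x hx
    rw [← Submodule.starProjection_eq_self_iff.2 hx, key]
    exact Submodule.smul_mem _ _ (Submodule.starProjection_apply_mem _ _)
  · intro x hx
    have h : Q.toSubmodule.starProjection x = κ • x := by
      rw [key, _root_.smul_apply, Submodule.starProjection_eq_self_iff.2 hx]
    rw [← inv_smul_smul₀ hκ0 x, ← h]
    exact Submodule.smul_mem _ _ (Submodule.starProjection_apply_mem _ _)

end QuotientModule

end

theorem theorem3p2 (n : ℕ) (hn : 1 ≤ n) (Q : QuotientModule n) :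
    Q.IsDoublyCommuting ↔
      ∃ q : Fin n → QuotientModule 1,
        Q.toSubmodule = HardySpace.hilbertTensor fun i => (q i).toSubmodule :=
  ⟨fun hQ => ⟨Q.slice, hQ.eq_hilbertTensor hn⟩,
    fun ⟨q, hq⟩ => Q.isDoublyCommuting_of_eq_hilbertTensor q hq⟩
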